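/- Filters are proper. A \emph{limit space} is a set $X$ with a relation $\mathcal F\to x$ between filters on $X$ and points of $X$ such that: the principal filter $[x]$ converges to $x$; if $\mathcal F\to x$ and $\mathcal G\to x$ then $\mathcal F\cap\mathcal G\to x$; if $\mathcal F\to x$ and $\mathcal G\supseteq\mathcal F$ then $\mathcal G\to x$. A map $f$ is continuous if $\mathcal F\to x$ implies $f(\mathcal F)\to f(x)$. A topological space is regarded as a limit space by its convergent filters, in particular $I=[0,1]$. The neighbourhood filter of $x$ is $\mathcal U(x)=\bigcap\{\mathcal F:\mathcal F\to x\}$; $X$ is \emph{pretopological} if $\mathcal U(x)\to x$ for all $x$, and \emph{pseudotopological} if $\mathcal F\to x$ whenever every ultrafilter containing $\mathcal F$ converges to $x$. The \emph{pretopological modification} of $X$ is the limit structure on the set $X$ in which $\mathcal F\to x$ iff $\mathcal F\supseteq\mathcal U(x)$. Subspaces and products carry the initial limit structure. The set $C(I,X)$ of continuous maps $I\to X$ carries the continuous limit structure: $\mathcal H\to f$ iff the image of $\mathcal H\times\mathcal F$ under evaluation converges to $f(t)$ whenever $\mathcal F\to t$ in $I$. For a surjection $q$ from a limit space $X$ onto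 a set $Y$, the \emph{quotient limit structure} on $Y$ is: $\mathcal F\to y$ iff there are $x_1,\dots,x_n\in q^{-1}(y)$ and $\mathcal F_k\to x_k$ with $q(\mathcal F_1)\cap\dots\cap q(\mathcal F_n)\subseteq\mathcal F$; the \emph{pseudotopological quotient structure} is the final pseudotopological structure on $Y$ with respect to $q$, i.e. the finest one making $q$ continuous. A \emph{covering system} of $X$ is a family of subsets of $X$ that meets every convergent filter. $X$ is \emph{connected} if it is not the disjoint union of two non-empty sets $A,B$ such that some covering system consists of subsets of $A$ and subsets of $B$. $X$ is \emph{locally path connected} if for each $x$ there is a family $\mathcal B_x$ of path connected subsets (as subspaces) such that every $\mathcal H\to x$ contains some $\mathcal F\to x$ that has a filter basis consisting of members of $\mathcal B_x$. $X$ is \emph{semi-locally simply connected} if it has a covering system such that every loop in a member of it is homotopic in $X$, relative to $\{0,1\}$, to a constant path. A \emph{covering map} $p:E\to X$ is a continuous surjection with discrete fibres (all points closed and open) such that, for some covering system $\mathcal V$ of $X$ and every $U\in\mathcal V$, there are a limit space $F$ and a homeomorphism $p^{-1}(U)\cong U\times F$ over $U$. A \emph{universal covering space} of $X$ is a covering map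 $p:E\to X$ with $E$ connected such that for every covering map $p':E'\to X$ with $E'$ connected there is a continuous $f:E\to E'$ with $p'f=p$. For $x_0\in X$ let $P(X,x_0)=\{\gamma\in C(I,X):\gamma(0)=x_0\}$, a subspace of $C(I,X)$, and let $\mathcal C$ be the set of classes $[\gamma]$ of paths $\gamma\in P(X,x_0)$ under homotopy relative to $\{0,1\}$, with the quotient limit structure along $\gamma\mapsto[\gamma]$. Let $\bar\varphi:\mathcal C\to X$, $\bar\varphi[\gamma]=\gamma(1)$. (1) Let $X$ be a connected, locally path connected, semi-locally simply connected pretopological space such that $C(I,X)$ is pretopological. Then, for every $x_0\in X$, $\mathcal C$ is pretopological. (2) Let $X$ be a connected, locally path connected, semi-locally simply connected topological space. Then, for every $x_0\in X$, $\mathcal C$ is pretopological. Moreover, the pretopological modification of $\mathcal C$ coincides with the pseudotopological quotient structure on the set $\mathcal C$ along $P(X,x_0)\to\mathcal C$, $\gamma\mapsto[\gamma]$, and with this structure $\bar\varphi:\mathcal C\to X$ is a universal covering space of $X$. -/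

import Mathlib

open Filter Topology
open scoped unitInterval

universe u v w

/-- A limit structure on a set `X`: a relation `conv F x` (the filter `F` converges to `x`) such that
principal ultrafilters converge to their point, the intersection of two filters converging to `x`
(their join `F ⊔ G` in the order used here) converges to `x`, and every finer filter `G ≤ F` of a
filter converging to `x` converges to `x`.
The improper filter `⊥` is a `Filter` here; it converges to every point by `mono`, so that limit
structures are in bijection with those defined by means of proper filters only. -/
@[ext]
structure LimitStructure (X : Type u) where
  conv : Filter X → X → Prop
  pure_conv : ∀ x, conv (pure x) x
  sup_conv : ∀ {F G : Filter X} {x}, conv F x → conv G x → conv (F ⊔ G) x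
  mono : ∀ {F G : Filter X} {x}, conv F x → G ≤ F → conv G x

namespace LimitStructure

variable {X : Type u} {Y : Type v} {Z : Type w}

/-! ### Continuity, neighbourhoods, classes of limit spaces -/

/-- `f` is continuous: `f(F) → f(x)` whenever `F → x`. -/
def Cont (L : LimitStructure X) (M : LimitStructure Y) (f : X → Y) : Prop :=
  ∀ (x : X) (F : Filter X), L.conv F x → M.conv (map f F) (f x)

theorem Cont.comp {L : LimitStructure X} {M : LimitStructure Y} {N : LimitStructure Z}
    {g : Y → Z} {f : X → Y} (hg : Cont M N g) (hf : Cont L M f) : Cont L N (g ∘ f) := by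
  intro x F hF
  have := hg _ _ (hf x F hF)
  rwa [map_map] at this

/-- The neighbourhood filter of `x`: the intersection of all filters converging to `x`. -/
def nbhd (L : LimitStructure X) (x : X) : Filter X := sSup {F | L.conv F x}

/-- Pretopological: the neighbourhood filter of each point converges to that point. -/
def IsPretopological (L : LimitStructure X) : Prop := ∀ x, L.conv (L.nbhd x) x

/-- Pseudotopological: `F → x` whenever every ultrafilter finer than `F` converges to `x`. -/
def IsPseudotopological (L : LimitStructure X) : Prop :=
  ∀ (F : Filter X) (x : X), (∀ G : Ultrafilter X, (G : Filter X) ≤ F → L.conv G x) → L.conv F x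

/-- The limit structure of a topological space: `F → x` iff `F` is finer than `𝓝 x`. -/
def ofTop (X : Type u) [TopologicalSpace X] : LimitStructure X where
  conv F x := F ≤ 𝓝 x
  pure_conv x := pure_le_nhds x
  sup_conv h₁ h₂ := sup_le h₁ h₂
  mono h₁ h₂ := h₂.trans h₁

/-- `A` is open: `A` belongs to every filter converging to a point of `A`. -/
def IsOpenSet (L : LimitStructure X) (A : Set X) : Prop :=
  ∀ x ∈ A, ∀ F, L.conv F x → A ∈ F

/-- `A` is closed: `A` contains the limits of all (proper) filters to which it belongs. -/
def IsClosedSet (L : LimitStructure X) (A : Set X) : Prop :=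
  ∀ (x : X) (F : Filter X), F.NeBot → A ∈ F → L.conv F x → x ∈ A

/-- Discrete: every point is closed and open. -/
def IsDiscrete (L : LimitStructure X) : Prop :=
  ∀ x : X, L.IsClosedSet {x} ∧ L.IsOpenSet {x}

/-! ### Subspaces, products, quotients, function spaces -/

/-- The initial limit structure with respect to a single map `f`. -/
def induced (f : X → Y) (M : LimitStructure Y) : LimitStructure X where
  conv F x := M.conv (map f F) (f x)
  pure_conv x := by rw [map_pure]; exact M.pure_conv _
  sup_conv h₁ h₂ := by rw [map_sup]; exact M.sup_conv h₁ h₂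
  mono h₁ h₂ := M.mono h₁ (map_mono h₂)

/-- The subspace limit structure on `A`. -/
def subspace (L : LimitStructure X) (A : Set X) : LimitStructure A :=
  induced Subtype.val L

/-- The product limit structure. -/
def prod (L : LimitStructure X) (M : LimitStructure Y) : LimitStructure (X × Y) where
  conv F p := L.conv (map Prod.fst F) p.1 ∧ M.conv (map Prod.snd F) p.2
  pure_conv p := by simp only [map_pure]; exact ⟨L.pure_conv _, M.pure_conv _⟩
  sup_conv h₁ h₂ := by
    simp only [map_sup]; exact ⟨L.sup_conv h₁.1 h₂.1, M.sup_conv h₁.2 h₂.2⟩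
  mono h₁ h₂ := ⟨L.mono h₁.1 (map_mono h₂), M.mono h₁.2 (map_mono h₂)⟩

/-- The quotient limit structure along a surjection `q`: `F → y` iff there are finitely many points
`a k` with `q (a k) = y` and filters `G k → a k` such that the intersection of the filters `q (G k)`
is contained in `F`. -/
def quotient (L : LimitStructure X) (q : X → Y) (hq : Function.Surjective q) :
    LimitStructure Y where
  conv F y := ∃ (n : ℕ) (a : Fin n → X) (G : Fin n → Filter X),
    (∀ k, q (a k) = y ∧ L.conv (G k) (a k)) ∧ F ≤ ⨆ k, map q (G k)
  pure_conv y := by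
    obtain ⟨x, rfl⟩ := hq y
    exact ⟨1, fun _ => x, fun _ => pure x, fun _ => ⟨rfl, L.pure_conv x⟩, by simp⟩
  sup_conv := by
    rintro F₁ F₂ y ⟨n, a, G, h, hF⟩ ⟨m, b, K, h', hF'⟩
    refine ⟨n + m, Fin.append a b, Fin.append G K, ?_, sup_le ?_ ?_⟩
    · intro k
      refine Fin.addCases (fun i => ?_) (fun i => ?_) k
      · simpa using h i
      · simpa using h' i
    · refine hF.trans (iSup_le fun k => ?_)
      refine le_iSup_of_le (Fin.castAdd m k) ?_
      simp
    · refine hF'.trans (iSup_le fun k => ?_)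
      refine le_iSup_of_le (Fin.natAdd n k) ?_
      simp
  mono := by
    rintro F₁ F₂ y ⟨n, a, G, h, hF⟩ hle
    exact ⟨n, a, G, h, hle.trans hF⟩

/-- The quotient structure in the category of pseudotopological spaces, that is the final
pseudotopological structure with respect to `q`: the finest pseudotopological structure on `Y`
for which `q` is continuous. Its universal property is proved below. -/
def pseudotopQuotient (L : LimitStructure X) (q : X → Y) : LimitStructure Y where
  conv F y := ∀ M : LimitStructure Y, M.IsPseudotopological → Cont L M q → M.conv F y
  pure_conv y M _ _ := M.pure_conv y
  sup_conv h₁ h₂ M hM hq := M.sup_conv (h₁ M hM hq) (h₂ M hM hq)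
  mono h₁ h₂ M hM hq := M.mono (h₁ M hM hq) h₂

theorem pseudotopQuotient_isPseudotopological (L : LimitStructure X) (q : X → Y) :
    (L.pseudotopQuotient q).IsPseudotopological :=
  fun F y h M hM hq => hM F y fun G hG => h G hG M hM hq

theorem induced_isPseudotopological (f : X → Y) {M : LimitStructure Y}
    (hM : M.IsPseudotopological) : (induced f M).IsPseudotopological := by
  intro F x h
  refine hM _ _ fun G hG => ?_
  have e : map f (F ⊓ comap f G) = G := by rw [Filter.push_pull, inf_eq_right.2 hG]
  have hne : (F ⊓ comap f G).NeBot := by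
    rw [← map_neBot_iff f, e]; exact G.neBot
  have hK : map f (Ultrafilter.of (F ⊓ comap f G) : Filter X) = G :=
    G.unique ((map_mono (Ultrafilter.of_le _)).trans_eq e)
  have := h (Ultrafilter.of (F ⊓ comap f G)) ((Ultrafilter.of_le _).trans inf_le_left)
  change M.conv (map f _) (f x) at this
  rwa [hK] at this

theorem cont_pseudotopQuotient_iff (L : LimitStructure X) (q : X → Y) {N : LimitStructure Z}
    (hN : N.IsPseudotopological) (g : Y → Z) :
    Cont (L.pseudotopQuotient q) N g ↔ Cont L N (g ∘ q) := by
  constructor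
  · intro hg
    exact hg.comp fun x F hF M _ hq => hq x F hF
  · intro h y F hF
    refine hF (induced g N) (induced_isPseudotopological g hN) ?_
    intro x G hG
    have := h x G hG
    rwa [← map_map] at this

/-- The pretopological modification: the filters converging to `x` are those finer than the
neighbourhood filter of `x`. -/
def pretopModification (L : LimitStructure X) : LimitStructure X where
  conv F x := F ≤ L.nbhd x
  pure_conv x := le_sSup (L.pure_conv x)
  sup_conv h₁ h₂ := sup_le h₁ h₂
  mono h₁ h₂ := h₂.trans h₁

/-- The set `C(X, Y)` of continuous maps. -/
def ContMap (L : LimitStructure X) (M : LimitStructure Y) : Type (max u v) :=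
  {f : X → Y // Cont L M f}

/-- The continuous limit structure on `C(X, Y)`: `H → f` iff the image of `H × F` under the
evaluation map converges to `f x` whenever `F → x`. -/
def contStructure (L : LimitStructure X) (M : LimitStructure Y) :
    LimitStructure (ContMap L M) where
  conv H f := ∀ (x : X) (F : Filter X), L.conv F x →
    M.conv (map (fun p : ContMap L M × X => p.1.1 p.2) (H ×ˢ F)) (f.1 x)
  pure_conv f x F hF := by
    rw [pure_prod, map_map]
    exact f.2 x F hF
  sup_conv h₁ h₂ x F hF := by
    rw [sup_prod, map_sup]
    exact M.sup_conv (h₁ x F hF) (h₂ x F hF)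
  mono h₁ h₂ x F hF := M.mono (h₁ x F hF) (map_mono (prod_mono h₂ le_rfl))

/-! ### Paths and homotopies of paths -/

/-- The unit interval with its usual topology, as a limit space. -/
def interval : LimitStructure I := ofTop I

/-- The path space `P(X, x₀)`: continuous paths `γ` in `X` with `γ(0) = x₀`. -/
def PathSpace (L : LimitStructure X) (x₀ : X) : Type u :=
  {γ : ContMap interval L // γ.1 0 = x₀}

/-- The limit structure of the path space, as a subspace of `C(I, X)`. -/
def pathStructure (L : LimitStructure X) (x₀ : X) : LimitStructure (PathSpace L x₀) :=
  induced Subtype.val (contStructure interval L)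

/-- Two maps `I → X` are homotopic relative to the end points `{0, 1}`. -/
def PathHomotopic (L : LimitStructure X) (f g : I → X) : Prop :=
  ∃ H : I × I → X, Cont (prod interval interval) L H ∧
    (∀ s, H (s, 0) = f s) ∧ (∀ s, H (s, 1) = g s) ∧
    (∀ t, H (0, t) = f 0) ∧ (∀ t, H (1, t) = f 1)

theorem prod_interval_conv {F : Filter (I × I)} {p : I × I} :
    (prod interval interval).conv F p ↔ F ≤ 𝓝 p := by
  rw [nhds_prod_eq, Filter.le_prod]
  rfl

theorem cont_of_continuous {f : I × I → I × I} (hf : Continuous f) :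
    Cont (prod interval interval) (prod interval interval) f := by
  intro p F hF
  rw [prod_interval_conv] at hF ⊢
  exact (map_mono hF).trans (hf.tendsto p)

theorem PathHomotopic.refl {L : LimitStructure X} {f : I → X} (hf : Cont interval L f) :
    PathHomotopic L f f := by
  refine ⟨fun p => f p.1, fun p F hF => ?_, fun _ => rfl, fun _ => rfl, fun _ => rfl, fun _ => rfl⟩
  have := hf _ _ hF.1
  rwa [map_map] at this

theorem PathHomotopic.symm {L : LimitStructure X} {f g : I → X} (h : PathHomotopic L f g) :
    PathHomotopic L g f := by
  obtain ⟨H, hH, h0, h1, hl, hr⟩ := h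
  refine ⟨H ∘ fun p => (p.1, σ p.2), hH.comp (cont_of_continuous (by fun_prop)), ?_, ?_, ?_, ?_⟩
  · intro s; simp [h1]
  · intro s; simp [h0]
  · intro t; simp [hl, ← h1]
  · intro t; simp [hr, ← h1]

theorem PathHomotopic.trans {L : LimitStructure X} {f g h : I → X} (hfg : PathHomotopic L f g)
    (hgh : PathHomotopic L g h) : PathHomotopic L f h := by
  classical
  obtain ⟨H, hH, h0, h1, hl, hr⟩ := hfg
  obtain ⟨K, hK, k0, k1, kl, kr⟩ := hgh
  let a : I × I → I × I := fun p => (p.1, Set.projIcc 0 1 zero_le_one (2 * (p.2 : ℝ)))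
  let b : I × I → I × I := fun p => (p.1, Set.projIcc 0 1 zero_le_one (2 * (p.2 : ℝ) - 1))
  have ha : Continuous a := by
    refine continuous_fst.prodMk (continuous_projIcc.comp ?_); fun_prop
  have hb : Continuous b := by
    refine continuous_fst.prodMk (continuous_projIcc.comp ?_); fun_prop
  have cH := hH.comp (cont_of_continuous ha)
  have cK := hK.comp (cont_of_continuous hb)
  let M : I × I → X := fun p => if (p.2 : ℝ) ≤ 1 / 2 then H (a p) else K (b p)
  have hM : ∀ p : I × I, M p = if (p.2 : ℝ) ≤ 1 / 2 then H (a p) else K (b p) := fun _ => rfl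
  refine ⟨M, fun p F hF => ?_, fun s => ?_, fun s => ?_, fun t => ?_, fun t => ?_⟩
  · have hFn : F ≤ 𝓝 p := prod_interval_conv.1 hF
    have c2 : Continuous fun p : I × I => (p.2 : ℝ) := by fun_prop
    rcases lt_trichotomy (p.2 : ℝ) (1 / 2) with hp | hp | hp
    · have e : M =ᶠ[F] H ∘ a := by
        filter_upwards [hFn ((isOpen_lt c2 continuous_const).mem_nhds hp)] with x hx
        simp only [hM, Function.comp, if_pos (le_of_lt hx)]
      rw [map_congr e, hM, if_pos hp.le]
      exact cH p F hF
    · have e1 : K (b p) = H (a p) := by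
        have : b p = (p.1, 0) := by simp [b, hp]
        rw [this, k0]
        have : a p = (p.1, 1) := by simp [a, hp]
        rw [this, h1]
      rw [hM, if_pos hp.le]
      have cK' := cK p F hF
      rw [Function.comp, e1] at cK'
      refine L.mono (L.sup_conv (cH p F hF) cK') ?_
      intro s hs
      rw [mem_sup, mem_map, mem_map] at hs
      rw [mem_map]
      filter_upwards [hs.1, hs.2] with x hx1 hx2
      simp only [Set.mem_preimage, hM]
      split_ifs
      · exact hx1
      · exact hx2
    · have e : M =ᶠ[F] K ∘ b := by
        filter_upwards [hFn ((isOpen_lt continuous_const c2).mem_nhds hp)] with x hx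
        simp only [hM, Function.comp, if_neg (not_le.2 hx)]
      rw [map_congr e, hM, if_neg (not_le.2 hp)]
      exact cK p F hF
  · have : a (s, 0) = (s, 0) := by simp [a]
    rw [hM, if_pos (by norm_num), this, h0]
  · have : b (s, 1) = (s, 1) := by simp [b]; norm_num
    rw [hM, if_neg (by norm_num), this, k1]
  · rw [hM]; split_ifs
    · exact hl _
    · exact (kl _).trans ((h1 0).symm.trans (hl 1))
  · rw [hM]; split_ifs
    · exact hr _
    · exact (kr _).trans ((h1 1).symm.trans (hr 1))

/-! ### Connectedness conditions -/

/-- `C` is a local covering system of `X` at `x`. -/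
def IsLocalCoverAt (L : LimitStructure X) (C : Set (Set X)) (x : X) : Prop :=
  ∀ F, L.conv F x → ∃ U ∈ C, U ∈ F

/-- `C` is a covering system of `X`. -/
def IsCover (L : LimitStructure X) (C : Set (Set X)) : Prop :=
  ∀ x, L.IsLocalCoverAt C x

/-- `B` is a local covering system base of `X` at `x`. -/
def IsLocalCoverBaseAt (L : LimitStructure X) (B : Set (Set X)) (x : X) : Prop :=
  ∀ H, L.conv H x → ∃ F, L.conv F x ∧ H ≤ F ∧ ∀ A ∈ F, ∃ U ∈ B, U ∈ F ∧ U ⊆ A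

/-- `X` is disconnected: it is a disjoint union of non-empty sets `A`, `B` and has a covering system
each member of which lies in `A` or in `B`. -/
def IsDisconnected (L : LimitStructure X) : Prop :=
  ∃ A B : Set X, A.Nonempty ∧ B.Nonempty ∧ A ∪ B = Set.univ ∧ A ∩ B = ∅ ∧
    ∃ C : Set (Set X), L.IsCover C ∧ ∀ U ∈ C, U ⊆ A ∨ U ⊆ B

def IsConnected (L : LimitStructure X) : Prop := ¬ L.IsDisconnected

def IsPathConnected (L : LimitStructure X) : Prop :=
  ∀ x y : X, ∃ γ : I → X, Cont interval L γ ∧ γ 0 = x ∧ γ 1 = y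

def IsLocallyPathConnected (L : LimitStructure X) : Prop :=
  ∀ x : X, ∃ B : Set (Set X), L.IsLocalCoverBaseAt B x ∧ ∀ U ∈ B, (L.subspace U).IsPathConnected

/-- Semi-locally simply connected: there is a covering system such that each loop in one of its
members is contractible in `X`, relative to its end points. -/
def IsSemilocallySimplyConnected (L : LimitStructure X) : Prop :=
  ∃ C : Set (Set X), L.IsCover C ∧ ∀ U ∈ C, ∀ γ : I → U, Cont interval (L.subspace U) γ →
    γ 0 = γ 1 → PathHomotopic L (fun t => (γ t : X)) (fun _ => (γ 0 : X))

/-! ### Covering maps -/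

/-- `p : E → X` is trivial over `U`: for some limit space `F` there is a homeomorphism
`p⁻¹(U) → U × F` over `U`. -/
def IsTrivialOver {E : Type v} (K : LimitStructure E) (L : LimitStructure X) (p : E → X)
    (U : Set X) : Prop :=
  ∃ (F : Type v) (N : LimitStructure F) (Φ : (p ⁻¹' U) ≃ U × F),
    Cont (K.subspace (p ⁻¹' U)) (prod (L.subspace U) N) Φ ∧
    Cont (prod (L.subspace U) N) (K.subspace (p ⁻¹' U)) Φ.symm ∧
    ∀ e : p ⁻¹' U, ((Φ e).1 : X) = p e

/-- `p` is a covering map: a continuous surjection which is trivial over the members of a covering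
system of `X`, with discrete fibres. -/
def IsCovering {E : Type v} (K : LimitStructure E) (L : LimitStructure X) (p : E → X) : Prop :=
  Cont K L p ∧ Function.Surjective p ∧
    (∃ C : Set (Set X), L.IsCover C ∧ ∀ U ∈ C, IsTrivialOver K L p U) ∧
    ∀ x : X, (K.subspace (p ⁻¹' {x})).IsDiscrete

/-- `p : E → X` is a universal covering space of `X`: it is a connected covering space, and it has
a morphism over `X` to every connected covering space of `X`. -/
def IsUniversalCovering {E : Type v} (K : LimitStructure E) (L : LimitStructure X) (p : E → X) :
    Prop :=
  IsCovering K L p ∧ K.IsConnected ∧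
    ∀ (E' : Type w) (K' : LimitStructure E') (p' : E' → X), IsCovering K' L p' → K'.IsConnected →
      ∃ f : E → E', Cont K K' f ∧ p' ∘ f = p

/-! ### The space of homotopy classes of paths -/

/-- Paths starting at `x₀` are equivalent if they have the same end point and are homotopic
relative to their end points. -/
def pathSetoid (L : LimitStructure X) (x₀ : X) : Setoid (PathSpace L x₀) where
  r γ γ' := γ.1.1 1 = γ'.1.1 1 ∧ PathHomotopic L γ.1.1 γ'.1.1
  iseqv := ⟨fun γ => ⟨rfl, PathHomotopic.refl γ.1.2⟩, fun h => ⟨h.1.symm, h.2.symm⟩,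
    fun h h' => ⟨h.1.trans h'.1, h.2.trans h'.2⟩⟩

/-- The set `𝒞` of classes `[γ]` of paths `γ` in `X` starting at `x₀`. -/
def PathClass (L : LimitStructure X) (x₀ : X) : Type u := Quotient (pathSetoid L x₀)

/-- The map `γ ↦ [γ]`. -/
def toClass (L : LimitStructure X) (x₀ : X) : PathSpace L x₀ → PathClass L x₀ :=
  Quotient.mk (pathSetoid L x₀)

theorem toClass_surjective (L : LimitStructure X) (x₀ : X) : Function.Surjective (L.toClass x₀) :=
  Quotient.mk_surjective

/-- The limit structure of `𝒞`: the quotient limit structure along `γ ↦ [γ]`. -/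
def classStructure (L : LimitStructure X) (x₀ : X) : LimitStructure (PathClass L x₀) :=
  (L.pathStructure x₀).quotient (L.toClass x₀) (L.toClass_surjective x₀)

/-- The end point map `𝒞 → X`, `[γ] ↦ γ(1)`. -/
def endpoint (L : LimitStructure X) (x₀ : X) : PathClass L x₀ → X :=
  Quotient.lift (fun γ => γ.1.1 1) fun _ _ h => h.1

end LimitStructure

/-!
The heart of the argument is a description of the neighbourhoods of a class `c` of paths: they are
generated by the sets `extensions c U` of the classes obtained from `c` by appending a path which
runs in `U`, where `U` is a neighbourhood of the end point of `c`. Write `extensionFilter c` for the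
filter with this basis.

* `extensionFilter c` converges to `c` in the quotient structure (`extensionFilter_conv`): appending
  short paths to `γ` converges, in the continuous structure, to `γ` followed by a constant path.
* The image of every filter of paths which converges to a representative of `c` is finer than
  `extensionFilter c` (`map_toClass_le_extensionFilter`). Let `S t` be this statement for the pieces
  of the paths up to time `t`. It holds at `t = 0`, and `S s ↔ S t` for `s` close to `t`: there all
  paths involved run in one set `V` whose loops contract, so that the small square formed by two
  nearby paths commutes up to homotopy. Hence `S` holds on the whole interval, which is connected.
  This requires that a neighbourhood of `γ t` is a neighbourhood of `γ s` for all `s` close to `t`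
  (`OpenAlongPaths`).

Together these say that the quotient structure is pretopological. The condition `OpenAlongPaths` is
plain for topological spaces. If `C(I, X)` is pretopological, it is proved by testing a
neighbourhood of `γ` in `C(I, X)` on the paths which follow `γ` except for a short detour at time
`s` (`openAlongPaths_of_isPretopological_contStructure`).

Homotopies are handled through the fundamental groupoid `PathHom` of a limit space. All its laws
come from one fact: two reparametrizations of a path with the same end points are homotopic.

In the topological case, the quotient structure is pretopological and hence pseudotopological, so
that it coincides with its pretopological modification and with the pseudotopological quotient. The
description of the neighbourhoods makes the end point map a covering, trivial over every open path
connected set whose loops contract. For the universal property, a covering of a topological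
space by a limit space is shown to be a covering of topological spaces
(`IsCovering.isCoveringMap`), so that paths and homotopies lift by Mathlib's theorems; the map sends
`[γ]` to the end point of the lift of `γ`, and it is continuous since an extension of `γ` by a short
path lifts through a local section (`exists_lift_endpoint`).
-/

namespace LimitStructure

variable {X : Type u} {L : LimitStructure X}

/-! ### Continuous maps from topological spaces to limit spaces -/

theorem cont_ofTop_iff {S T : Type*} [TopologicalSpace S] [TopologicalSpace T] {f : S → T} :
    Cont (ofTop S) (ofTop T) f ↔ Continuous f := by
  rw [continuous_iff_continuousAt]
  exact ⟨fun h x => h x _ le_rfl, fun h x F hF => (map_mono hF).trans (h x)⟩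

theorem Cont.comp_continuous {S T : Type*} [TopologicalSpace S] [TopologicalSpace T] {f : T → X}
    (hf : Cont (ofTop T) L f) {r : S → T} (hr : Continuous r) : Cont (ofTop S) L (f ∘ r) :=
  hf.comp (cont_ofTop_iff.2 hr)

theorem cont_prod_interval_iff {f : I × I → X} :
    Cont (prod interval interval) L f ↔ Cont (ofTop (I × I)) L f := by
  simp only [Cont, prod_interval_conv]
  rfl

theorem cont_const {S : Type*} {M : LimitStructure S} (x : X) : Cont M L fun _ => x := by
  intro s F _
  refine L.mono (L.pure_conv x) ?_
  rw [← map_pure (fun _ : S => x) s]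
  intro A hA
  simp only [map_pure, mem_pure] at hA
  exact mem_map.2 (univ_mem' fun _ => hA)

/-- Pasting along the closed sets `{a ≤ b}` and `{b ≤ a}`. At a common point of the two, the image
filter is finer than the intersection of two convergent filters. -/
theorem cont_ite_le {T : Type*} [TopologicalSpace T] {a b : T → ℝ} (ha : Continuous a)
    (hb : Continuous b) {f g : T → X} (hf : Cont (ofTop T) L f) (hg : Cont (ofTop T) L g)
    (h : ∀ t, a t = b t → f t = g t) :
    Cont (ofTop T) L fun t => if a t ≤ b t then f t else g t := by
  intro p F hF
  change L.conv _ (if a p ≤ b p then f p else g p)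
  rcases lt_trichotomy (a p) (b p) with hp | hp | hp
  · have e : (fun t => if a t ≤ b t then f t else g t) =ᶠ[F] f := by
      filter_upwards [hF ((isOpen_lt ha hb).mem_nhds hp)] with x hx
      exact if_pos (le_of_lt hx)
    rw [map_congr e, if_pos hp.le]
    exact hf p F hF
  · rw [if_pos hp.le]
    have hg' := hg p F hF
    rw [← h p hp] at hg'
    refine L.mono (L.sup_conv (hf p F hF) hg') fun s hs => ?_
    rw [mem_sup, mem_map, mem_map] at hs
    rw [mem_map]
    filter_upwards [hs.1, hs.2] with x hx1 hx2
    simp only [Set.mem_preimage]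
    split_ifs
    · exact hx1
    · exact hx2
  · have e : (fun t => if a t ≤ b t then f t else g t) =ᶠ[F] g := by
      filter_upwards [hF ((isOpen_lt hb ha).mem_nhds hp)] with x hx
      exact if_neg (not_le.2 hx)
    rw [map_congr e, if_neg (not_le.2 hp)]
    exact hg p F hF

theorem cont_subspace_iff {S : Type*} {M : LimitStructure S} {A : Set X} {f : S → A} :
    Cont M (L.subspace A) f ↔ Cont M L fun s => (f s : X) := by
  simp only [Cont, subspace, induced, map_map]
  rfl

/-- In a pretopological space, convergence to `x` means refining the neighbourhood filter. -/
theorem IsPretopological.conv_iff (hL : L.IsPretopological) {F : Filter X} {x : X} :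
    L.conv F x ↔ F ≤ L.nbhd x :=
  ⟨fun h => le_sSup h, fun h => L.mono (hL x) h⟩

theorem mem_of_mem_nbhd {x : X} {U : Set X} (h : U ∈ L.nbhd x) : x ∈ U :=
  (le_sSup (L.pure_conv x) : pure x ≤ L.nbhd x) h

/-! ### Homotopy classes of paths -/

/-- The affine map `t ↦ 2 t`, cut off to the unit interval. -/
noncomputable def firstHalf (t : I) : I := Set.projIcc 0 1 zero_le_one (2 * (t : ℝ))

/-- The affine map `t ↦ 2 t - 1`, cut off to the unit interval. -/
noncomputable def secondHalf (t : I) : I := Set.projIcc 0 1 zero_le_one (2 * (t : ℝ) - 1)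

theorem continuous_firstHalf : Continuous firstHalf :=
  continuous_projIcc.comp (by fun_prop)

theorem continuous_secondHalf : Continuous secondHalf :=
  continuous_projIcc.comp (by fun_prop)

/-- Concatenation of two maps `I → X`; it is a path if `f` and `g` are paths and `f 1 = g 0`. -/
noncomputable def concat {X : Type*} (f g : I → X) (t : I) : X :=
  if (t : ℝ) ≤ 1 / 2 then f (firstHalf t) else g (secondHalf t)

theorem firstHalf_half {t : I} (h : (t : ℝ) = 1 / 2) : firstHalf t = 1 := by simp [firstHalf, h]

theorem secondHalf_half {t : I} (h : (t : ℝ) = 1 / 2) : secondHalf t = 0 := by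
  simp [secondHalf, h]

theorem concat_zero {X : Type*} (f g : I → X) : concat f g 0 = f 0 := by
  simp [concat, firstHalf]

theorem concat_one {X : Type*} (f g : I → X) : concat f g 1 = g 1 := by
  have : ¬ ((1 : I) : ℝ) ≤ 1 / 2 := by norm_num
  rw [concat, if_neg this, secondHalf]
  congr 1
  norm_num

theorem comp_concat {X Y : Type*} (F : Y → X) (f g : I → Y) :
    F ∘ concat f g = concat (F ∘ f) (F ∘ g) := by
  ext t
  simp only [concat, Function.comp]
  split_ifs <;> rfl

theorem cont_concat {f g : I → X} (hf : Cont interval L f) (hg : Cont interval L g)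
    (h : f 1 = g 0) : Cont interval L (concat f g) := by
  refine cont_ite_le (by fun_prop) (by fun_prop) (Cont.comp_continuous hf continuous_firstHalf)
    (Cont.comp_continuous hg continuous_secondHalf) fun t ht => ?_
  simp [firstHalf_half ht, secondHalf_half ht, h]

theorem continuous_concat {T : Type*} [TopologicalSpace T] {f g : I → T} (hf : Continuous f)
    (hg : Continuous g) (h : f 1 = g 0) : Continuous (concat f g) :=
  cont_ofTop_iff.1 (cont_concat (cont_ofTop_iff.2 hf) (cont_ofTop_iff.2 hg) h)

theorem PathHomotopic.concat {f f' g g' : I → X} (hf : PathHomotopic L f f')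
    (hg : PathHomotopic L g g') (h : f 1 = g 0) :
    PathHomotopic L (concat f g) (concat f' g') := by
  obtain ⟨H, hH, h0, h1, hl, hr⟩ := hf
  obtain ⟨K, hK, k0, k1, kl, kr⟩ := hg
  rw [cont_prod_interval_iff] at hH hK
  have c1 : Continuous fun p : I × I => (firstHalf p.1, p.2) :=
    (continuous_firstHalf.comp continuous_fst).prodMk continuous_snd
  have c2 : Continuous fun p : I × I => (secondHalf p.1, p.2) :=
    (continuous_secondHalf.comp continuous_fst).prodMk continuous_snd
  refine ⟨fun p => LimitStructure.concat (fun s => H (s, p.2)) (fun s => K (s, p.2)) p.1,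
    ?_, fun s => ?_, fun s => ?_, fun t => ?_, fun t => ?_⟩
  · rw [cont_prod_interval_iff]
    refine cont_ite_le (by fun_prop) (by fun_prop) (hH.comp_continuous c1)
      (hK.comp_continuous c2) fun t ht => ?_
    simp [firstHalf_half ht, secondHalf_half ht, hr, kl, h]
  · simp only [h0, k0]
  · simp only [h1, k1]
  · simp only [concat_zero, hl]
  · simp only [concat_one, kr]

/-- Reparametrizations of a path which agree at the end points are homotopic, by the straight-line
homotopy in the interval. -/
theorem pathHomotopic_reparam {f : I → X} (hf : Cont interval L f) {r r' : I → I}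
    (hr : Continuous r) (hr' : Continuous r') (h0 : r 0 = r' 0) (h1 : r 1 = r' 1) :
    PathHomotopic L (f ∘ r) (f ∘ r') := by
  let k : I × I → I := fun p =>
    Set.projIcc 0 1 zero_le_one ((1 - (p.2 : ℝ)) * (r p.1 : ℝ) + (p.2 : ℝ) * (r' p.1 : ℝ))
  have hk : Continuous k := continuous_projIcc.comp (by fun_prop)
  refine ⟨f ∘ k, cont_prod_interval_iff.2 (Cont.comp_continuous hf hk), fun s => ?_, fun s => ?_,
    fun t => ?_, fun t => ?_⟩
  · simp [k]
  · simp [k]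
  · have : (1 - (t : ℝ)) * (r' 0 : ℝ) + (t : ℝ) * (r' 0 : ℝ) = r' 0 := by ring
    simp [k, h0, this]
  · have : (1 - (t : ℝ)) * (r' 1 : ℝ) + (t : ℝ) * (r' 1 : ℝ) = r' 1 := by ring
    simp [k, h1, this]

/-- Homotopy relative to the end points, as an equivalence relation on the paths from `x`
to `y`. -/
def pathFromToSetoid (L : LimitStructure X) (x y : X) :
    Setoid {f : I → X // Cont interval L f ∧ f 0 = x ∧ f 1 = y} where
  r f g := PathHomotopic L f.1 g.1
  iseqv := ⟨fun f => PathHomotopic.refl f.2.1, fun h => h.symm, fun h h' => h.trans h'⟩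

/-- Homotopy classes, relative to the end points, of paths from `x` to `y`. These are the morphisms
of the fundamental groupoid of the limit space. -/
def PathHom (L : LimitStructure X) (x y : X) : Type u := Quotient (pathFromToSetoid L x y)

namespace PathHom

variable {x y z w : X}

/-- The class of a path. The end points are given by equations, so that `x` and `y` need not be
syntactically `f 0` and `f 1`. -/
def mk (f : I → X) (hf : Cont interval L f) (h0 : f 0 = x) (h1 : f 1 = y) : PathHom L x y :=
  Quotient.mk (pathFromToSetoid L x y) ⟨f, hf, h0, h1⟩

theorem exists_mk (a : PathHom L x y) :
    ∃ (f : I → X) (hf : Cont interval L f) (h0 : f 0 = x) (h1 : f 1 = y), mk f hf h0 h1 = a := by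
  obtain ⟨⟨f, hf, h0, h1⟩, rfl⟩ := Quotient.exists_rep a
  exact ⟨f, hf, h0, h1, rfl⟩

theorem mk_eq_mk {f g : I → X} {hf : Cont interval L f} {hg : Cont interval L g} {h0 : f 0 = x}
    {h1 : f 1 = y} {k0 : g 0 = x} {k1 : g 1 = y} :
    mk f hf h0 h1 = mk g hg k0 k1 ↔ PathHomotopic L f g :=
  Quotient.eq (r := pathFromToSetoid L x y)

/-- Composition of classes of paths, by concatenation. -/
noncomputable def comp (a : PathHom L x y) (b : PathHom L y z) : PathHom L x z :=
  Quotient.map₂ (fun f g => ⟨concat f.1 g.1, cont_concat f.2.1 g.2.1 (f.2.2.2.trans g.2.2.1.symm),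
    (concat_zero _ _).trans f.2.2.1, (concat_one _ _).trans g.2.2.2⟩)
    (fun f _ hf g _ hg => PathHomotopic.concat hf hg (f.2.2.2.trans g.2.2.1.symm)) a b

theorem mk_comp_mk {f g : I → X} (hf : Cont interval L f) (hg : Cont interval L g) (h0 : f 0 = x)
    (h1 : f 1 = y) (k0 : g 0 = y) (k1 : g 1 = z) :
    (mk f hf h0 h1).comp (mk g hg k0 k1) =
      mk (concat f g) (cont_concat hf hg (h1.trans k0.symm)) ((concat_zero _ _).trans h0)
        ((concat_one _ _).trans k1) := rfl

/-- Consecutive pieces of one path compose to a piece of it. The laws for constant and reversed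
paths are instances of this. -/
theorem mk_reparam_comp {f : I → X} (hf : Cont interval L f) {r s t : I → I} (hr : Continuous r)
    (hs : Continuous s) (ht : Continuous t) (h : r 1 = s 0) (h0 : t 0 = r 0) (h1 : t 1 = s 1)
    {fr : Cont interval L (f ∘ r)} {fs : Cont interval L (f ∘ s)} {ft : Cont interval L (f ∘ t)}
    {r0 : (f ∘ r) 0 = x} {r1 : (f ∘ r) 1 = y} {s0 : (f ∘ s) 0 = y} {s1 : (f ∘ s) 1 = z}
    {t0 : (f ∘ t) 0 = x} {t1 : (f ∘ t) 1 = z} :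
    (mk (f ∘ r) fr r0 r1).comp (mk (f ∘ s) fs s0 s1) = mk (f ∘ t) ft t0 t1 := by
  rw [mk_comp_mk, mk_eq_mk, ← comp_concat]
  exact pathHomotopic_reparam hf (continuous_concat hr hs h) ht
    ((concat_zero _ _).trans h0.symm) ((concat_one _ _).trans h1.symm)

/-- The class of the constant path. -/
def id (L : LimitStructure X) (x : X) : PathHom L x x := mk (fun _ => x) (cont_const x) rfl rfl

/-- The class of the reversed path. -/
noncomputable def inv (a : PathHom L x y) : PathHom L y x :=
  Quotient.map (fun f => ⟨f.1 ∘ σ, Cont.comp_continuous f.2.1 unitInterval.continuous_symm,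
    by simpa using f.2.2.2, by simpa using f.2.2.1⟩)
    (by
      rintro ⟨f, hf⟩ ⟨g, hg⟩ ⟨H, hH, h0, h1, hl, hr⟩
      refine ⟨H ∘ fun p => (σ p.1, p.2), hH.comp (cont_of_continuous (by fun_prop)),
        fun s => ?_, fun s => ?_, fun t => ?_, fun t => ?_⟩ <;> simp [*]) a

theorem inv_mk {f : I → X} (hf : Cont interval L f) (h0 : f 0 = x) (h1 : f 1 = y) :
    (mk f hf h0 h1).inv = mk (f ∘ σ) (Cont.comp_continuous hf unitInterval.continuous_symm)
      (by simpa using h1) (by simpa using h0) := rfl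

theorem id_comp (a : PathHom L x y) : (id L x).comp a = a := by
  obtain ⟨f, hf, rfl, rfl, rfl⟩ := exists_mk a
  exact mk_reparam_comp hf (r := fun _ => 0) (s := fun t => t) (t := fun t => t)
    continuous_const continuous_id continuous_id rfl rfl rfl

theorem comp_id (a : PathHom L x y) : a.comp (id L y) = a := by
  obtain ⟨f, hf, rfl, rfl, rfl⟩ := exists_mk a
  exact mk_reparam_comp hf (r := fun t => t) (s := fun _ => 1) (t := fun t => t)
    continuous_id continuous_const continuous_id rfl rfl rfl

theorem comp_inv (a : PathHom L x y) : a.comp a.inv = id L x := by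
  obtain ⟨f, hf, rfl, rfl, rfl⟩ := exists_mk a
  rw [inv_mk]
  exact mk_reparam_comp hf (r := fun t => t) (s := σ) (t := fun _ => 0)
    continuous_id unitInterval.continuous_symm continuous_const (by simp) rfl (by simp)

theorem inv_comp (a : PathHom L x y) : a.inv.comp a = id L y := by
  obtain ⟨f, hf, rfl, rfl, rfl⟩ := exists_mk a
  rw [inv_mk]
  exact mk_reparam_comp hf (r := σ) (s := fun t => t) (t := fun _ => 1)
    unitInterval.continuous_symm continuous_id continuous_const (by simp) (by simp) rfl

theorem comp_assoc (a : PathHom L x y) (b : PathHom L y z) (c : PathHom L z w) :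
    (a.comp b).comp c = a.comp (b.comp c) := by
  obtain ⟨f, hf, rfl, rfl, rfl⟩ := exists_mk a
  obtain ⟨g, hg, hfg, rfl, rfl⟩ := exists_mk b
  obtain ⟨h, hh, hgh, rfl, rfl⟩ := exists_mk c
  rw [mk_comp_mk, mk_comp_mk, mk_comp_mk, mk_comp_mk, mk_eq_mk]
  -- The three paths are pieces of the path `F`.
  set F := concat (concat f g) h with hF
  have cF : Cont interval L F :=
    cont_concat (cont_concat hf hg hfg.symm) hh ((concat_one f g).trans hgh.symm)
  let q : ℝ → ℝ → I → I := fun a b t => Set.projIcc 0 1 zero_le_one (a * (t : ℝ) + b)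
  have cq : ∀ a b, Continuous (q a b) := fun a b => continuous_projIcc.comp (by fun_prop)
  have e1 : f = F ∘ q (1 / 4) 0 := by
    ext t
    have := t.2.1
    have := t.2.2
    have a1 : ((q (1 / 4) 0 t : I) : ℝ) = t / 4 := by
      simp only [q]; rw [Set.projIcc_of_mem _ ⟨by linarith, by linarith⟩]; simp; ring
    have a2 : ((firstHalf (q (1 / 4) 0 t) : I) : ℝ) = t / 2 := by
      rw [firstHalf, a1, Set.projIcc_of_mem _ ⟨by linarith, by linarith⟩]
      ring
    have a3 : firstHalf (firstHalf (q (1 / 4) 0 t)) = t := by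
      rw [firstHalf, a2, mul_div_cancel₀ _ two_ne_zero, Set.projIcc_val]
    simp only [Function.comp, hF, concat]
    rw [if_pos (by rw [a1]; linarith), if_pos (by rw [a2]; linarith), a3]
  have e2 : g = F ∘ q (1 / 4) (1 / 4) := by
    ext t
    have := t.2.1
    have := t.2.2
    have a1 : ((q (1 / 4) (1 / 4) t : I) : ℝ) = t / 4 + 1 / 4 := by
      simp only [q]; rw [Set.projIcc_of_mem _ ⟨by linarith, by linarith⟩]; simp; ring
    have a2 : ((firstHalf (q (1 / 4) (1 / 4) t) : I) : ℝ) = t / 2 + 1 / 2 := by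
      rw [firstHalf, a1, Set.projIcc_of_mem _ ⟨by linarith, by linarith⟩]; simp; ring
    have a3 : secondHalf (firstHalf (q (1 / 4) (1 / 4) t)) = t := by
      rw [secondHalf, a2]; ring_nf; simp
    simp only [Function.comp, hF, concat]
    rw [if_pos (by rw [a1]; linarith), a3]
    split_ifs with h'
    · have t0 : t = 0 := Subtype.ext
          (le_antisymm (by rw [a2] at h'; change (t : ℝ) ≤ 0; linarith) t.2.1)
      have : ((firstHalf (q (1 / 4) (1 / 4) t) : I) : ℝ) = 1 / 2 := by rw [a2, t0]; simp
      rw [firstHalf_half this, t0, hfg]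
    · rfl
  have e3 : h = F ∘ q (1 / 2) (1 / 2) := by
    ext t
    have := t.2.1
    have := t.2.2
    have a1 : ((q (1 / 2) (1 / 2) t : I) : ℝ) = t / 2 + 1 / 2 := by
      simp only [q]; rw [Set.projIcc_of_mem _ ⟨by linarith, by linarith⟩]; simp; ring
    have a2 : secondHalf (q (1 / 2) (1 / 2) t) = t := by
      rw [secondHalf, a1]; ring_nf; simp
    have : F (q (1 / 2) (1 / 2) t) =
        if ((q (1 / 2) (1 / 2) t : I) : ℝ) ≤ 1 / 2 then
          concat f g (firstHalf (q (1 / 2) (1 / 2) t)) else h t := by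
      rw [hF, concat, a2]
    rw [Function.comp, this]
    split_ifs with h'
    · have t0 : t = 0 := Subtype.ext
          (le_antisymm (by rw [a1] at h'; change (t : ℝ) ≤ 0; linarith) t.2.1)
      have : ((q (1 / 2) (1 / 2) t : I) : ℝ) = 1 / 2 := by rw [a1, t0]; simp
      rw [firstHalf_half this, t0, concat_one, hgh]
    · rfl
  have e : concat f (concat g h) =
      F ∘ concat (q (1 / 4) 0) (concat (q (1 / 4) (1 / 4)) (q (1 / 2) (1 / 2))) := by
    rw [comp_concat, comp_concat, ← e1, ← e2, ← e3]
  have b1 : q (1 / 4) 0 1 = q (1 / 4) (1 / 4) 0 := by simp [q]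
  have b2 : q (1 / 4) (1 / 4) 1 = q (1 / 2) (1 / 2) 0 := by simp [q]; norm_num
  rw [e]
  refine pathHomotopic_reparam (r := fun t => t) cF continuous_id (continuous_concat (cq _ _)
    (continuous_concat (cq _ _) (cq _ _) b2) ?_) ?_ ?_
  · rw [concat_zero, b1]
  · rw [concat_zero]; simp [q]
  · rw [concat_one, concat_one]; simp only [q]
    norm_num

/-- The class contains a path which runs in `U`. -/
def Within (U : Set X) (a : PathHom L x y) : Prop :=
  ∃ (f : I → X) (hf : Cont interval L f) (h0 : f 0 = x) (h1 : f 1 = y),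
    (∀ t, f t ∈ U) ∧ mk f hf h0 h1 = a

theorem Within.mono {U V : Set X} {a : PathHom L x y} (h : a.Within U) (hUV : U ⊆ V) :
    a.Within V := by
  obtain ⟨f, hf, h0, h1, hU, rfl⟩ := h
  exact ⟨f, hf, h0, h1, fun t => hUV (hU t), rfl⟩

theorem Within.comp {U : Set X} {a : PathHom L x y} {b : PathHom L y z} (ha : a.Within U)
    (hb : b.Within U) : (a.comp b).Within U := by
  obtain ⟨f, hf, h0, h1, hU, rfl⟩ := ha
  obtain ⟨g, hg, k0, k1, hV, rfl⟩ := hb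
  refine ⟨_, _, _, _, fun t => ?_, (mk_comp_mk hf hg h0 h1 k0 k1).symm⟩
  unfold concat
  split_ifs
  · exact hU _
  · exact hV _

theorem Within.inv {U : Set X} {a : PathHom L x y} (ha : a.Within U) : a.inv.Within U := by
  obtain ⟨f, hf, h0, h1, hU, rfl⟩ := ha
  exact ⟨_, _, _, _, fun t => hU _, (inv_mk hf h0 h1).symm⟩

theorem Within.right_mem {U : Set X} {a : PathHom L x y} (ha : a.Within U) : y ∈ U := by
  obtain ⟨f, hf, h0, h1, hU, rfl⟩ := ha
  exact h1 ▸ hU 1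

theorem within_id {U : Set X} (h : x ∈ U) : (id L x).Within U :=
  ⟨_, _, _, _, fun _ => h, rfl⟩

end PathHom

/-- Each loop in `U` is contractible in the whole space. -/
def LoopsContract (L : LimitStructure X) (U : Set X) : Prop :=
  ∀ (x : X) (a : L.PathHom x x), a.Within U → a = PathHom.id L x

theorem LoopsContract.mono {U V : Set X} (h : L.LoopsContract V) (hUV : U ⊆ V) :
    L.LoopsContract U := fun x a ha => h x a (ha.mono hUV)

theorem LoopsContract.eq {U : Set X} (h : L.LoopsContract U) {x y : X} {a b : L.PathHom x y}
    (ha : a.Within U) (hb : b.Within U) : a = b := by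
  have := h x _ (ha.comp hb.inv)
  rw [← a.comp_id, ← b.inv_comp, ← PathHom.comp_assoc, this, b.id_comp]

/-- Any two points of `U` are joined by a path in `U`. -/
def Joins (L : LimitStructure X) (U : Set X) : Prop :=
  ∀ x ∈ U, ∀ y ∈ U, ∃ a : L.PathHom x y, a.Within U

theorem joins_of_isPathConnected {U : Set X} (h : (L.subspace U).IsPathConnected) :
    L.Joins U := by
  intro x hx y hy
  obtain ⟨γ, hγ, h0, h1⟩ := h ⟨x, hx⟩ ⟨y, hy⟩
  exact ⟨_, _, cont_subspace_iff.1 hγ, by simp [h0], by simp [h1], fun t => (γ t).2, rfl⟩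

theorem IsSemilocallySimplyConnected.exists_nbhd (h : L.IsSemilocallySimplyConnected)
    (hL : L.IsPretopological) (x : X) : ∃ U ∈ L.nbhd x, L.LoopsContract U := by
  obtain ⟨C, hC, hU⟩ := h
  obtain ⟨U, hUC, hx⟩ := hC x _ (hL x)
  refine ⟨U, hx, fun y a ha => ?_⟩
  obtain ⟨f, hf, h0, h1, hfU, rfl⟩ := ha
  have := hU U hUC (fun t => ⟨f t, hfU t⟩) (cont_subspace_iff.2 hf) (Subtype.ext (h0.trans h1.symm))
  subst h0
  exact PathHom.mk_eq_mk.2 this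

theorem IsLocallyPathConnected.exists_nbhd (h : L.IsLocallyPathConnected)
    (hL : L.IsPretopological) {x : X} {U : Set X} (hU : U ∈ L.nbhd x) :
    ∃ V ∈ L.nbhd x, V ⊆ U ∧ L.Joins V := by
  obtain ⟨B, hB, hp⟩ := h x
  obtain ⟨F, hF, hle, hb⟩ := hB _ (hL x)
  rw [le_antisymm (hL.conv_iff.1 hF) hle] at hb
  obtain ⟨V, hV, hVx, hVU⟩ := hb U hU
  exact ⟨V, hVx, hVU, joins_of_isPathConnected (hp V hV)⟩

variable {x₀ : X}

/-! ### Pieces of a path -/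

/-- The affine path in the interval from `s` to `t`. -/
noncomputable def segmentPath (s t r : I) : I :=
  Set.projIcc 0 1 zero_le_one ((1 - (r : ℝ)) * s + r * t)

theorem continuous_segmentPath (s t : I) : Continuous (segmentPath s t) :=
  continuous_projIcc.comp (by fun_prop)

theorem segmentPath_self (s r : I) : segmentPath s s r = s := by
  have : (1 - (r : ℝ)) * s + r * s = s := by ring
  simp [segmentPath, this]

@[simp] theorem segmentPath_zero (s t : I) : segmentPath s t 0 = s := by simp [segmentPath]

@[simp] theorem segmentPath_one (s t : I) : segmentPath s t 1 = t := by simp [segmentPath]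

theorem segmentPath_zero_one (r : I) : segmentPath 0 1 r = r := by simp [segmentPath]

theorem segmentPath_mem {b c s t : I} (hs : s ∈ Set.Icc b c) (ht : t ∈ Set.Icc b c) (r : I) :
    segmentPath s t r ∈ Set.Icc b c := by
  have hr := r.2
  have hr' : 0 ≤ 1 - (r : ℝ) := sub_nonneg.2 hr.2
  have h1 : (b : ℝ) ≤ s := hs.1
  have h2 : (s : ℝ) ≤ c := hs.2
  have h3 : (b : ℝ) ≤ t := ht.1
  have h4 : (t : ℝ) ≤ c := ht.2
  have l : (b : ℝ) ≤ (1 - (r : ℝ)) * s + r * t := by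
    nlinarith [mul_le_mul_of_nonneg_left h1 hr', mul_le_mul_of_nonneg_left h3 hr.1]
  have m : (1 - (r : ℝ)) * s + r * t ≤ (c : ℝ) := by
    nlinarith [mul_le_mul_of_nonneg_left h2 hr', mul_le_mul_of_nonneg_left h4 hr.1]
  rw [segmentPath, Set.projIcc_of_mem _ ⟨b.2.1.trans l, m.trans c.2.2⟩]
  exact ⟨l, m⟩

/-- A path from `x₀`, as a point of the path space. -/
def toPathSpace (f : I → X) (hf : Cont interval L f) (h0 : f 0 = x₀) : PathSpace L x₀ :=
  Subtype.mk (Subtype.mk f hf) h0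

theorem map_map_prod {A B C D : Type*} (f : A → B) (e : B × C → D) (H : Filter A)
    (F : Filter C) :
    map e (map f H ×ˢ F) = map (fun p : A × C => e (f p.1, p.2)) (H ×ˢ F) := by
  have : map f H ×ˢ F = map (Prod.map f _root_.id) (H ×ˢ F) := by
    rw [← prod_map_map_eq', map_id]
  rw [this, map_map]
  rfl

theorem pathStructure_conv_iff {H : Filter (PathSpace L x₀)} {γ : PathSpace L x₀} :
    (L.pathStructure x₀).conv H γ ↔ ∀ (t : I) (F : Filter I), F ≤ 𝓝 t →
      L.conv (map (fun p : PathSpace L x₀ × I => p.1.1.1 p.2) (H ×ˢ F)) (γ.1.1 t) := by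
  refine forall₃_congr fun t F _ => ?_
  exact iff_of_eq (congrArg (L.conv · (γ.1.1 t))
    (map_map_prod Subtype.val (fun p : ContMap interval L × I => p.1.1 p.2) H F))

namespace PathHom

variable {x y z : X}

/-- The class of the piece of the path `f` between the times `s` and `t`. -/
noncomputable def piece (f : I → X) (hf : Cont interval L f) (s t : I) (hs : f s = x)
    (ht : f t = y) : PathHom L x y :=
  mk (f ∘ segmentPath s t) (Cont.comp_continuous hf (continuous_segmentPath s t))
    (by simpa using hs) (by simpa using ht)

theorem piece_comp_piece {f : I → X} (hf : Cont interval L f) {r s t : I} (hr : f r = x)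
    (hs : f s = y) (ht : f t = z) :
    (piece f hf r s hr hs).comp (piece f hf s t hs ht) = piece f hf r t hr ht :=
  mk_reparam_comp hf (continuous_segmentPath r s) (continuous_segmentPath s t)
    (continuous_segmentPath r t) (by simp) (by simp) (by simp)

theorem piece_within {f : I → X} (hf : Cont interval L f) {U : Set X} {b c s t : I}
    (hU : ∀ r ∈ Set.Icc b c, f r ∈ U) (hsI : s ∈ Set.Icc b c) (htI : t ∈ Set.Icc b c)
    (hs : f s = x) (ht : f t = y) : (piece f hf s t hs ht).Within U :=
  ⟨_, _, _, _, fun r => hU _ (segmentPath_mem hsI htI r), rfl⟩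

theorem piece_zero_one {f : I → X} (hf : Cont interval L f) (h0 : f 0 = x) (h1 : f 1 = y) :
    piece f hf 0 1 h0 h1 = mk f hf h0 h1 := by
  have : f ∘ segmentPath 0 1 = f := funext fun r => congrArg f (segmentPath_zero_one r)
  simp only [piece, this]

/-! ### The set of homotopy classes and its basic neighbourhoods -/

/-- The class of a path starting at `x₀`, as a point of `𝒞`. -/
def toPathClass (a : PathHom L x₀ y) : PathClass L x₀ :=
  Quotient.lift (fun f => L.toClass x₀ ⟨⟨f.1, f.2.1⟩, f.2.2.1⟩)
    (fun f g h => Quotient.sound ⟨f.2.2.2.trans g.2.2.2.symm, h⟩) a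

theorem endpoint_toPathClass (a : PathHom L x₀ y) : L.endpoint x₀ a.toPathClass = y := by
  obtain ⟨f, hf, h0, h1, rfl⟩ := exists_mk a
  exact h1

theorem toPathClass_injective : Function.Injective (toPathClass : PathHom L x₀ y → _) := by
  intro a b h
  obtain ⟨f, hf, h0, h1, rfl⟩ := exists_mk a
  obtain ⟨g, hg, k0, k1, rfl⟩ := exists_mk b
  exact mk_eq_mk.2 (Quotient.exact h).2

end PathHom

open PathHom

theorem exists_toPathClass (c : PathClass L x₀) :
    ∃ a : PathHom L x₀ (L.endpoint x₀ c), a.toPathClass = c := by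
  obtain ⟨γ, rfl⟩ := L.toClass_surjective x₀ c
  exact ⟨PathHom.mk γ.1.1 γ.1.2 γ.2 rfl, rfl⟩

/-- The classes obtained from `c` by appending a path which runs in `U`. -/
def extensions (L : LimitStructure X) (x₀ : X) (c : PathClass L x₀) (U : Set X) :
    Set (PathClass L x₀) :=
  {d | ∃ (y z : X) (a : PathHom L x₀ y) (g : PathHom L y z),
    a.toPathClass = c ∧ g.Within U ∧ (a.comp g).toPathClass = d}

theorem extensions_mono (c : PathClass L x₀) : Monotone (L.extensions x₀ c) := by
  rintro U V h d ⟨y, z, a, g, ha, hg, hd⟩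
  exact ⟨y, z, a, g, ha, hg.mono h, hd⟩

theorem mem_extensions_toPathClass {y : X} {a : PathHom L x₀ y} {U : Set X}
    {d : PathClass L x₀} :
    d ∈ L.extensions x₀ a.toPathClass U ↔
      ∃ (z : X) (g : PathHom L y z), g.Within U ∧ (a.comp g).toPathClass = d := by
  refine ⟨?_, fun ⟨z, g, hg, hd⟩ => ⟨y, z, a, g, rfl, hg, hd⟩⟩
  rintro ⟨y', z, a', g, ha, hg, hd⟩
  obtain rfl : y' = y := by rw [← endpoint_toPathClass a', ha, endpoint_toPathClass]
  obtain rfl := toPathClass_injective ha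
  exact ⟨z, g, hg, hd⟩

/-- The filter on `𝒞` with the basis of all `extensions c U`, for the neighbourhoods `U` of the end
point of `c`. It turns out to be the neighbourhood filter of `c`. -/
def extensionFilter (L : LimitStructure X) (x₀ : X) (c : PathClass L x₀) :
    Filter (PathClass L x₀) :=
  (L.nbhd (L.endpoint x₀ c)).lift' (L.extensions x₀ c)

theorem mem_extensionFilter {c : PathClass L x₀} {S : Set (PathClass L x₀)} :
    S ∈ L.extensionFilter x₀ c ↔ ∃ U ∈ L.nbhd (L.endpoint x₀ c), L.extensions x₀ c U ⊆ S :=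
  mem_lift'_sets (extensions_mono c)

/-! ### The quotient structure is determined by the extension filters -/

/-- Appending to a path `γ` shorter and shorter paths at its end gives a filter of paths which
converges to `γ` followed by a constant path. -/
theorem extensionFilter_conv (hL : L.IsPretopological) (c : PathClass L x₀) :
    (L.classStructure x₀).conv (L.extensionFilter x₀ c) c := by
  obtain ⟨γ, rfl⟩ := L.toClass_surjective x₀ c
  have hγ := γ.1.2
  let E : Set X → Set (PathSpace L x₀) := fun U => {μ | ∃ α : I → X, Cont interval L α ∧
    α 0 = γ.1.1 1 ∧ (∀ t, α t ∈ U) ∧ μ.1.1 = concat γ.1.1 α}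
  have hE : Monotone E := fun U V h μ ⟨α, h1, h2, h3, h4⟩ => ⟨α, h1, h2, fun t => h (h3 t), h4⟩
  let H : Filter (PathSpace L x₀) := (L.nbhd (γ.1.1 1)).lift' E
  let δ : PathSpace L x₀ := toPathSpace (concat γ.1.1 fun _ => γ.1.1 1)
    (cont_concat hγ (cont_const _) rfl) ((concat_zero _ _).trans γ.2)
  have hδ : L.toClass x₀ δ = L.toClass x₀ γ := by
    exact congrArg toPathClass (comp_id (PathHom.mk γ.1.1 hγ γ.2 rfl))
  refine ⟨1, fun _ => δ, fun _ => H, fun _ => ⟨hδ, ?_⟩, ?_⟩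
  · refine pathStructure_conv_iff.2 fun t F hF => ?_
    have c2 : Continuous fun s : I => (s : ℝ) := continuous_subtype_val
    have hconv := Cont.comp_continuous hγ continuous_firstHalf t F hF
    change L.conv _ (if (t : ℝ) ≤ 1 / 2 then γ.1.1 (firstHalf t) else γ.1.1 1)
    rcases lt_trichotomy (t : ℝ) (1 / 2) with ht | ht | ht
    · rw [if_pos ht.le]
      refine L.mono hconv fun S hS => mem_map.2 (mem_prod_iff.2 ⟨_, mem_lift' univ_mem, _,
        inter_mem hS (hF ((isOpen_lt c2 continuous_const).mem_nhds ht)), ?_⟩)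
      rintro ⟨μ, s⟩ ⟨⟨α, -, -, -, e⟩, hs, hs'⟩
      have hs' : (s : ℝ) < 1 / 2 := hs'
      have e : μ.1.1 = concat γ.1.1 α := e
      change μ.1.1 s ∈ S
      rw [e, concat, if_pos hs'.le]
      exact hs
    · rw [if_pos ht.le]
      have hB := hL (γ.1.1 1)
      rw [Function.comp, firstHalf_half ht] at hconv
      rw [firstHalf_half ht]
      refine L.mono (L.sup_conv hconv hB) fun S hS => mem_map.2 (mem_prod_iff.2
        ⟨_, mem_lift' (mem_sup.1 hS).2, _, (mem_sup.1 hS).1, ?_⟩)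
      rintro ⟨μ, s⟩ ⟨⟨α, -, -, hα, e⟩, hs⟩
      have e : μ.1.1 = concat γ.1.1 α := e
      change μ.1.1 s ∈ S
      rw [e, concat]
      split_ifs
      · exact hs
      · exact hα _
    · rw [if_neg ht.not_ge]
      refine L.mono (hL (γ.1.1 1)) fun S hS => mem_map.2 (mem_prod_iff.2 ⟨_, mem_lift' hS, _,
        hF ((isOpen_lt continuous_const c2).mem_nhds ht), ?_⟩)
      rintro ⟨μ, s⟩ ⟨⟨α, -, -, hα, e⟩, hs⟩
      have hs : 1 / 2 < (s : ℝ) := hs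
      have e : μ.1.1 = concat γ.1.1 α := e
      change μ.1.1 s ∈ S
      rw [e, concat, if_neg hs.not_ge]
      exact hα _
  · rw [iSup_const]
    intro S hS
    obtain ⟨U, hU, hUS⟩ := (mem_lift'_sets hE).1 (mem_map.1 hS)
    refine mem_extensionFilter.2 ⟨U, hU, fun d hd => ?_⟩
    obtain ⟨z, g, ⟨α, hα, h0, h1, hαU, rfl⟩, rfl⟩ :=
      (mem_extensions_toPathClass (a := PathHom.mk γ.1.1 hγ γ.2 rfl)).1 hd
    exact hUS (a := toPathSpace (concat γ.1.1 α) (cont_concat hγ hα h0.symm)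
      ((concat_zero _ _).trans γ.2)) ⟨α, hα, h0, hαU, rfl⟩

/-- A neighbourhood of a point of a path is a neighbourhood of all nearby points of the path.
Topological spaces have this property, since their neighbourhoods contain open ones. -/
def OpenAlongPaths (L : LimitStructure X) : Prop :=
  ∀ f : I → X, Cont interval L f → ∀ t, ∀ V ∈ L.nbhd (f t), ∀ᶠ s in 𝓝 t, V ∈ L.nbhd (f s)

/-- Paths close to `γ` are, up to homotopy, `γ` followed by a short path. -/
theorem map_toClass_le_extensionFilter (hL : L.IsPretopological) (hp : L.IsLocallyPathConnected)
    (hs : L.IsSemilocallySimplyConnected) (ho : L.OpenAlongPaths) {H : Filter (PathSpace L x₀)}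
    {γ : PathSpace L x₀} (hH : (L.pathStructure x₀).conv H γ) :
    map (L.toClass x₀) H ≤ L.extensionFilter x₀ (L.toClass x₀ γ) := by
  have hH' : ∀ (t : I) (F : Filter I), F ≤ 𝓝 t →
      map (fun p : PathSpace L x₀ × I => p.1.1.1 p.2) (H ×ˢ F) ≤ L.nbhd (γ.1.1 t) := fun t F hF =>
    hL.conv_iff.1 (pathStructure_conv_iff.1 hH t F hF)
  -- `S t` says that near `γ` the initial piece of a path up to time `t` is, up to homotopy, the
  -- initial piece of `γ` followed by a path in a prescribed neighbourhood of `γ t`.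
  let S : I → Prop := fun t => ∀ W ∈ L.nbhd (γ.1.1 t), ∀ᶠ μ in H,
    ∃ g : PathHom L (γ.1.1 t) (μ.1.1 t), g.Within W ∧
      (piece γ.1.1 γ.1.2 0 t γ.2 rfl).comp g = piece μ.1.1 μ.1.2 0 t μ.2 rfl
  have hS0 : S 0 := by
    intro W hW
    refine univ_mem' fun μ => ?_
    have e : γ.1.1 0 = μ.1.1 0 := γ.2.trans μ.2.symm
    refine ⟨PathHom.mk (fun _ => γ.1.1 0) (cont_const _) rfl e,
      ⟨_, _, _, _, fun _ => mem_of_mem_nbhd hW, rfl⟩, ?_⟩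
    have e' : concat (γ.1.1 ∘ segmentPath 0 0) (fun _ => γ.1.1 0) = μ.1.1 ∘ segmentPath 0 0 := by
      ext r
      simp only [concat, Function.comp, segmentPath_self, ite_self, e]
    refine (mk_comp_mk _ _ _ _ _ _).trans (mk_eq_mk.2 ?_)
    rw [e']
    exact PathHomotopic.refl (Cont.comp_continuous μ.1.2 (continuous_segmentPath 0 0))
  have hloc : ∀ t, ∀ᶠ s in 𝓝 t, (S s ↔ S t) := by
    intro t
    obtain ⟨V, hV, hVc⟩ := hs.exists_nbhd hL (γ.1.1 t)
    obtain ⟨A, hA, J, hJ, hAJ⟩ := mem_prod_iff.1 (mem_map.1 (hH' t _ le_rfl hV))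
    obtain ⟨b, c, htI, hI, hIJ⟩ :=
      exists_Icc_mem_subset_of_mem_nhds (inter_mem hJ (ho _ γ.1.2 t V hV))
    have key : ∀ r ∈ Set.Icc b c, ∀ r' ∈ Set.Icc b c, S r → S r' := by
      intro r hr r' hr' h W hW
      obtain ⟨W', hW', hWV, hj⟩ := hp.exists_nbhd hL (inter_mem hW (hIJ hr').2)
      have hev : ∀ᶠ μ in H, μ.1.1 r' ∈ W' := by
        have := hH' r' (pure r') (pure_le_nhds r') hW'
        rwa [prod_pure, map_map] at this
      filter_upwards [hA, hev, h V (hIJ hr).2] with μ hμ hμ' ⟨g, hg, e⟩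
      obtain ⟨g', hg'⟩ := hj _ (mem_of_mem_nbhd hW') _ hμ'
      refine ⟨g', hg'.mono fun x hx => (hWV hx).1, ?_⟩
      have h1 : (piece γ.1.1 γ.1.2 r r' rfl rfl).Within V :=
        piece_within γ.1.2 (fun q hq => mem_of_mem_nbhd (hIJ hq).2) hr hr' _ _
      have h2 : (piece μ.1.1 μ.1.2 r r' rfl rfl).Within V :=
        piece_within μ.1.2 (fun q hq => hAJ (Set.mk_mem_prod hμ (hIJ hq).1)) hr hr' _ _
      have := hVc.eq (h1.comp (hg'.mono fun x hx => (hWV hx).2)) (hg.comp h2)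
      rw [← piece_comp_piece γ.1.2 γ.2 rfl rfl (s := r), comp_assoc, this, ← comp_assoc, e,
        piece_comp_piece]
    filter_upwards [hI] with s hs
    exact ⟨key s hs t htI, key t htI s hs⟩
  have hclopen : IsClopen {t | S t} := by
    refine ⟨⟨isOpen_iff_mem_nhds.2 fun t ht => ?_⟩, isOpen_iff_mem_nhds.2 fun t ht => ?_⟩
    · filter_upwards [hloc t] with s hs using fun h => ht (hs.1 h)
    · filter_upwards [hloc t] with s hs using hs.2 ht
  have hS1 : S 1 := by
    have := hclopen.eq_univ ⟨0, hS0⟩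
    exact (Set.eq_univ_iff_forall.1 this) 1
  intro B hB
  obtain ⟨U, hU, hUB⟩ := mem_extensionFilter.1 hB
  rw [mem_map]
  filter_upwards [hS1 U hU] with μ ⟨g, hg, e⟩
  rw [piece_zero_one, piece_zero_one] at e
  exact hUB ⟨_, _, PathHom.mk γ.1.1 γ.1.2 γ.2 rfl, g, rfl, hg, congrArg toPathClass e⟩

/-- The quotient structure on `𝒞` is pretopological, with the extension filters as neighbourhood
filters. -/
theorem classStructure_conv_iff (hL : L.IsPretopological) (hp : L.IsLocallyPathConnected)
    (hs : L.IsSemilocallySimplyConnected) (ho : L.OpenAlongPaths) {F : Filter (PathClass L x₀)}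
    {c : PathClass L x₀} :
    (L.classStructure x₀).conv F c ↔ F ≤ L.extensionFilter x₀ c := by
  refine ⟨?_, fun h => (L.classStructure x₀).mono (extensionFilter_conv hL c) h⟩
  rintro ⟨n, a, G, h, hF⟩
  refine hF.trans (iSup_le fun k => ?_)
  rw [← (h k).1]
  exact map_toClass_le_extensionFilter hL hp hs ho (h k).2

theorem classStructure_isPretopological (hL : L.IsPretopological) (hp : L.IsLocallyPathConnected)
    (hs : L.IsSemilocallySimplyConnected) (ho : L.OpenAlongPaths) :
    (L.classStructure x₀).IsPretopological := fun _ =>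
  (classStructure_conv_iff hL hp hs ho).2 (sSup_le fun _ hF =>
    (classStructure_conv_iff hL hp hs ho).1 hF)

/-! ### Neighbourhoods along paths -/

theorem nbhd_ofTop {X : Type u} [TopologicalSpace X] (x : X) : (ofTop X).nbhd x = 𝓝 x :=
  le_antisymm (sSup_le fun _ h => h) (le_sSup (le_refl (𝓝 x)))

theorem isPretopological_ofTop {X : Type u} [TopologicalSpace X] :
    (ofTop X).IsPretopological := fun x => (nbhd_ofTop x).le

theorem openAlongPaths_ofTop {X : Type u} [TopologicalSpace X] : (ofTop X).OpenAlongPaths := by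
  intro f hf t V hV
  simp only [nbhd_ofTop] at hV ⊢
  exact ((cont_ofTop_iff.1 hf).tendsto t).eventually (eventually_mem_nhds_iff.2 hV)

/-- A map of the interval to itself which moves each point by at most `δ`, towards `s`, and which
maps all points at distance at most `δ` from `s` to `s`. -/
noncomputable def pullTowards (s : I) (δ : ℝ) (t : I) : I :=
  Set.projIcc 0 1 zero_le_one ((t : ℝ) - max (-δ) (min δ ((t : ℝ) - s)))

theorem continuous_pullTowards (s : I) (δ : ℝ) : Continuous (pullTowards s δ) :=
  continuous_projIcc.comp (by fun_prop)

theorem coe_pullTowards (s : I) {δ : ℝ} (hδ : 0 < δ) (t : I) :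
    (pullTowards s δ t : ℝ) = (t : ℝ) - max (-δ) (min δ ((t : ℝ) - s)) := by
  have hs := s.2
  have ht := t.2
  rw [pullTowards, Set.projIcc_of_mem]
  constructor <;> rcases max_cases (-δ) (min δ ((t : ℝ) - s)) with h | h <;>
    rcases min_cases δ ((t : ℝ) - s) with h' | h' <;> linarith [hs.1, hs.2, ht.1, ht.2]

theorem dist_pullTowards_le (s : I) {δ : ℝ} (hδ : 0 < δ) (t : I) :
    dist (pullTowards s δ t) t ≤ δ := by
  rw [Subtype.dist_eq, Real.dist_eq, coe_pullTowards s hδ, abs_le]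
  constructor <;> rcases max_cases (-δ) (min δ ((t : ℝ) - s)) with h | h <;>
    rcases min_cases δ ((t : ℝ) - s) with h' | h' <;> linarith

theorem dist_pullTowards_center_le (s : I) {δ : ℝ} (hδ : 0 < δ) (t : I) :
    dist (pullTowards s δ t) s ≤ dist t s := by
  rw [Subtype.dist_eq, Subtype.dist_eq, Real.dist_eq, Real.dist_eq, coe_pullTowards s hδ, abs_le]
  constructor <;> rcases max_cases (-δ) (min δ ((t : ℝ) - s)) with h | h <;>
    rcases min_cases δ ((t : ℝ) - s) with h' | h' <;>
    rcases abs_cases ((t : ℝ) - s) with h'' | h'' <;> linarith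

theorem pullTowards_eq (s : I) {δ : ℝ} (hδ : 0 < δ) {t : I} (h : dist t s ≤ δ) :
    pullTowards s δ t = s := by
  rw [Subtype.dist_eq, Real.dist_eq, abs_le] at h
  apply Subtype.ext
  rw [coe_pullTowards s hδ, min_eq_right h.2, max_eq_right h.1]
  ring

/-- The path `f`, stopped at time `s` for a detour along `α` and back, which reaches `α 1` at time
`s` and takes place at distance at most `δ` from `s`. -/
noncomputable def detour {X : Type*} (f α : I → X) (s : I) (δ : ℝ) (t : I) : X :=
  if dist t s ≤ δ then α (Set.projIcc 0 1 zero_le_one (1 - dist t s / δ))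
  else f (pullTowards s δ t)

theorem cont_detour {f α : I → X} (hf : Cont interval L f) (hα : Cont interval L α) {s : I}
    (h : α 0 = f s) {δ : ℝ} (hδ : 0 < δ) : Cont interval L (detour f α s δ) := by
  have c : Continuous fun t : I => dist t s := by fun_prop
  refine cont_ite_le (f := α ∘ fun t : I => Set.projIcc 0 1 zero_le_one (1 - dist t s / δ))
    (g := f ∘ pullTowards s δ) c continuous_const
    (Cont.comp_continuous hα (continuous_projIcc.comp (by fun_prop)))
    (Cont.comp_continuous hf (continuous_pullTowards s δ)) fun t ht => ?_
  simp only [Function.comp, ht, div_self hδ.ne', sub_self, Set.projIcc_left,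
    pullTowards_eq s hδ ht.le]
  exact h

theorem detour_center {X : Type*} (f α : I → X) (s : I) {δ : ℝ} (hδ : 0 < δ) :
    detour f α s δ s = α 1 := by
  simp [detour, hδ.le]

/-- The filter of the detours of `f` at time `s` which are short both in time and in space. -/
def detourFilter (L : LimitStructure X) (f : I → X) (s : I) : Filter (ContMap interval L) where
  sets := {S | ∃ W ∈ L.nbhd (f s), ∃ ε > 0, ∀ δ, 0 < δ → δ ≤ ε → ∀ α : I → X, Cont interval L α →
    α 0 = f s → (∀ t, α t ∈ W) → ∀ μ : ContMap interval L, μ.1 = detour f α s δ → μ ∈ S}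
  univ_sets := ⟨Set.univ, univ_mem, 1, one_pos, fun _ _ _ _ _ _ _ _ _ => trivial⟩
  sets_of_superset := by
    rintro S T ⟨W, hW, ε, hε, h⟩ hST
    exact ⟨W, hW, ε, hε, fun δ h1 h2 α h3 h4 h5 μ h6 => hST (h δ h1 h2 α h3 h4 h5 μ h6)⟩
  inter_sets := by
    rintro S T ⟨W, hW, ε, hε, h⟩ ⟨W', hW', ε', hε', h'⟩
    refine ⟨W ∩ W', inter_mem hW hW', min ε ε', lt_min hε hε', fun δ h1 h2 α h3 h4 h5 μ h6 => ?_⟩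
    exact ⟨h δ h1 (h2.trans (min_le_left _ _)) α h3 h4 (fun t => (h5 t).1) μ h6,
      h' δ h1 (h2.trans (min_le_right _ _)) α h3 h4 (fun t => (h5 t).2) μ h6⟩

theorem mem_detourFilter {f : I → X} {s : I} {S : Set (ContMap interval L)} :
    S ∈ detourFilter L f s ↔ ∃ W ∈ L.nbhd (f s), ∃ ε > 0, ∀ δ, 0 < δ → δ ≤ ε → ∀ α : I → X,
      Cont interval L α → α 0 = f s → (∀ t, α t ∈ W) → ∀ μ : ContMap interval L,
        μ.1 = detour f α s δ → μ ∈ S := Iff.rfl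

theorem detourFilter_conv (hL : L.IsPretopological) (f : ContMap interval L) (s : I) :
    (contStructure interval L).conv (detourFilter L f.1 s) f := by
  intro t F hF
  rw [hL.conv_iff]
  intro V hV
  have hF' : F ≤ 𝓝 t := hF
  obtain ⟨ρ, hρ, hρV⟩ := Metric.mem_nhds_iff.1 (hL.conv_iff.1 (f.2 t (𝓝 t) le_rfl) hV)
  rw [mem_map, mem_prod_iff]
  by_cases hts : t = s
  · -- Near `s` a detour is either on `f`, close to `f s`, or on the detour proper.
    subst hts
    refine ⟨{μ | ∀ r, dist r t < ρ → μ.1 r ∈ V}, mem_detourFilter.2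
      ⟨V, hV, 1, one_pos, fun δ hδ _ α _ _ hα μ hμ r hr => ?_⟩, Metric.ball t ρ,
      hF' (Metric.ball_mem_nhds t hρ), fun p hp => hp.1 _ hp.2⟩
    rw [hμ, detour]
    split_ifs
    · exact hα _
    · exact hρV ((dist_pullTowards_center_le t hδ r).trans_lt hr)
  · -- Away from `s` a sufficiently short detour is a reparametrization of `f` close to `f`.
    have hd : 0 < dist t s := dist_pos.2 hts
    set ε := min ρ (dist t s) / 3 with hε
    have hm : 0 < min ρ (dist t s) := lt_min hρ hd
    have e0 : 0 < ε := by positivity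
    have e1 : 3 * ε ≤ ρ := by rw [hε]; linarith [min_le_left ρ (dist t s)]
    have e2 : 3 * ε ≤ dist t s := by rw [hε]; linarith [min_le_right ρ (dist t s)]
    refine ⟨{μ | ∀ r, dist r t < ε → μ.1 r ∈ V}, mem_detourFilter.2
      ⟨Set.univ, univ_mem, ε, e0, fun δ hδ hδε α _ _ _ μ hμ r hr => ?_⟩, Metric.ball t ε,
      hF' (Metric.ball_mem_nhds t e0), fun p hp => hp.1 _ hp.2⟩
    have h1 := dist_triangle_left t s r
    rw [hμ, detour, if_neg (by linarith)]
    refine hρV ?_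
    have h2 := dist_triangle (pullTowards s δ r) r t
    have h3 := dist_pullTowards_le s hδ r
    rw [Metric.mem_ball]
    linarith

/-- Neighbourhoods are stable along paths if `C(I, X)` is pretopological: some neighbourhood of
`f` maps a fixed neighbourhood of `t` into `V`, and among its members are detours of `f` from a
nearby time `s` to every point of some neighbourhood of `f s`. -/
theorem openAlongPaths_of_isPretopological_contStructure (hL : L.IsPretopological)
    (hp : L.IsLocallyPathConnected) (hC : (contStructure interval L).IsPretopological) :
    L.OpenAlongPaths := by
  intro f hf t V hV
  let f' : ContMap interval L := Subtype.mk f hf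
  have h1 := hL.conv_iff.1 (hC f' t (𝓝 t) le_rfl) hV
  obtain ⟨A, hA, J, hJ, hAJ⟩ := mem_prod_iff.1 (mem_map.1 h1)
  filter_upwards [hJ] with s hs
  obtain ⟨W, hW, ε, hε, h⟩ := mem_detourFilter.1
    ((le_sSup (detourFilter_conv hL f' s) : _ ≤ (contStructure interval L).nbhd f') hA)
  obtain ⟨W', hW', hWW', hj⟩ := hp.exists_nbhd hL hW
  refine mem_of_superset hW' fun y hy => ?_
  obtain ⟨a, α, hα, h0, rfl, hαW, -⟩ := hj _ (mem_of_mem_nbhd hW') y hy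
  have hμ := h ε hε le_rfl α hα h0 (fun r => hWW' (hαW r))
    (Subtype.mk (detour f α s ε) (cont_detour hf hα h0 hε)) rfl
  have := hAJ (Set.mk_mem_prod hμ hs)
  change detour f α s ε s ∈ V at this
  rwa [detour_center f α s hε] at this

/-! ### The pseudotopological quotient -/

theorem IsPretopological.isPseudotopological (hL : L.IsPretopological) :
    L.IsPseudotopological := fun _ _ h =>
  hL.conv_iff.2 (le_iff_ultrafilter.2 fun G hG => hL.conv_iff.1 (h G hG))

theorem IsPretopological.pretopModification_eq (hL : L.IsPretopological) :
    L.pretopModification = L := by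
  ext F x
  exact hL.conv_iff.symm

theorem cont_quotient {Y : Type v} (q : X → Y) (hq : Function.Surjective q) :
    Cont L (L.quotient q hq) q :=
  fun x F hF => ⟨1, fun _ => x, fun _ => F, fun _ => ⟨rfl, hF⟩, by rw [iSup_const]⟩

/-- The quotient structure is the finest limit structure which makes `q` continuous, so that it is
the pseudotopological quotient as soon as it is pseudotopological. -/
theorem quotient_eq_pseudotopQuotient {Y : Type v} {q : X → Y} (hq : Function.Surjective q)
    (h : (L.quotient q hq).IsPseudotopological) : L.quotient q hq = L.pseudotopQuotient q := by
  ext F y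
  refine ⟨?_, fun hF => hF _ h (cont_quotient q hq)⟩
  rintro ⟨n, a, G, hG, hF⟩ M - hM
  refine M.mono ?_ hF
  have hk : ∀ k, M.conv (map q (G k)) y := fun k => (hG k).1 ▸ hM _ _ (hG k).2
  clear hF hG
  induction n with
  | zero => exact M.mono (M.pure_conv y) (iSup_le fun k => k.elim0)
  | succ n ih =>
    refine M.mono (M.sup_conv (hk 0)
      (ih (fun k => a k.succ) (fun k => G k.succ) fun k => hk k.succ)) (iSup_le fun k => ?_)
    refine Fin.cases le_sup_left (fun j => ?_) k
    exact le_sup_of_le_right (le_iSup (fun j : Fin n => map q (G j.succ)) j)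

/-! ### Connectedness -/

/-- A connected and locally path connected pretopological space is path connected. -/
theorem exists_pathHom (hL : L.IsPretopological) (hc : L.IsConnected)
    (hp : L.IsLocallyPathConnected) (x y : X) : Nonempty (L.PathHom x y) := by
  by_contra hy
  refine hc ⟨{z | Nonempty (L.PathHom x z)}, {z | Nonempty (L.PathHom x z)}ᶜ,
    ⟨x, ⟨PathHom.id L x⟩⟩, ⟨y, hy⟩, Set.union_compl_self _, Set.inter_compl_self _,
    {U | L.Joins U}, fun z F hF => ?_, fun U hU => ?_⟩
  · obtain ⟨V, hV, -, hj⟩ := hp.exists_nbhd hL (univ_mem : Set.univ ∈ L.nbhd z)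
    exact ⟨V, hj, hL.conv_iff.1 hF hV⟩
  · by_cases h : ∃ z ∈ U, Nonempty (L.PathHom x z)
    · obtain ⟨z, hz, ⟨a⟩⟩ := h
      refine Or.inl fun z' hz' => ?_
      obtain ⟨g, -⟩ := hU z hz z' hz'
      exact ⟨a.comp g⟩
    · exact Or.inr fun z hz hz' => h ⟨z, hz, hz'⟩

/-- A limit space in which some point is joined to all others by paths is connected. -/
theorem isConnected_of_paths (x : X)
    (h : ∀ y, ∃ f : I → X, Cont interval L f ∧ f 0 = x ∧ f 1 = y) : L.IsConnected := by
  rintro ⟨A, B, ⟨a, ha⟩, ⟨b, hb⟩, hAB, hdis, C, hC, hU⟩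
  have key : ∀ y, (x ∈ A ↔ y ∈ A) := by
    intro y
    obtain ⟨f, hf, rfl, rfl⟩ := h y
    have hloc : ∀ t, ∀ᶠ s in 𝓝 t, (f s ∈ A ↔ f t ∈ A) := by
      intro t
      obtain ⟨U, hUC, hUf⟩ := hC _ _ (hf t (𝓝 t) le_rfl)
      have ht : f t ∈ U := mem_of_mem_nhds (s := f ⁻¹' U) (mem_map.1 hUf)
      rcases hU U hUC with h' | h'
      · filter_upwards [mem_map.1 hUf] with s hs
        exact iff_of_true (h' hs) (h' ht)
      · have hB : ∀ z ∈ U, z ∉ A := fun z hz hzA => (hdis ▸ ⟨hzA, h' hz⟩ : z ∈ (∅ : Set X))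
        filter_upwards [mem_map.1 hUf] with s hs
        exact iff_of_false (hB _ hs) (hB _ ht)
    have hclopen : IsClopen {t | f t ∈ A} := by
      refine ⟨⟨isOpen_iff_mem_nhds.2 fun t ht => ?_⟩, isOpen_iff_mem_nhds.2 fun t ht => ?_⟩
      · filter_upwards [hloc t] with s hs using fun h => ht (hs.1 h)
      · filter_upwards [hloc t] with s hs using hs.2 ht
    rcases isClopen_iff.1 hclopen with e | e
    · exact iff_of_false (Set.eq_empty_iff_forall_notMem.1 e 0)
        (Set.eq_empty_iff_forall_notMem.1 e 1)
    · exact iff_of_true (Set.eq_univ_iff_forall.1 e 0) (Set.eq_univ_iff_forall.1 e 1)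
  have : b ∈ A := (key b).1 ((key a).2 ha)
  exact (hdis ▸ ⟨this, hb⟩ : b ∈ (∅ : Set X))

/-- The initial pieces of `γ` form a path in `𝒞` from the class of the constant path to the class
of `γ`. -/
theorem isConnected_classStructure : (L.classStructure x₀).IsConnected := by
  refine isConnected_of_paths (PathHom.id L x₀).toPathClass fun c => ?_
  obtain ⟨γ, rfl⟩ := L.toClass_surjective x₀ c
  let G : I → PathSpace L x₀ := fun s => toPathSpace (fun t => γ.1.1 (s * t))
    (Cont.comp_continuous γ.1.2 (continuous_const.mul continuous_id)) (by simpa using γ.2)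
  have hG : Cont interval (L.pathStructure x₀) G := by
    intro s F hF
    refine pathStructure_conv_iff.2 fun t F' hF' => ?_
    have hmul : map (fun p : I × I => p.1 * p.2) (F ×ˢ F') ≤ 𝓝 (s * t) := by
      refine (map_mono (prod_mono hF hF')).trans ?_
      rw [← nhds_prod_eq]
      exact (continuous_fst.mul continuous_snd).tendsto (s, t)
    have := γ.1.2 _ _ hmul
    rw [map_map] at this
    rw [map_map_prod]
    exact this
  refine ⟨L.toClass x₀ ∘ G, (cont_quotient _ _).comp hG, ?_, ?_⟩
  · have : G 0 = toPathSpace (fun _ => x₀) (cont_const x₀) rfl := by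
      apply Subtype.ext
      apply Subtype.ext
      funext t
      change γ.1.1 (0 * t) = x₀
      rw [zero_mul, γ.2]
    exact congrArg (L.toClass x₀) this
  · have : G 1 = γ := by
      apply Subtype.ext
      apply Subtype.ext
      funext t
      change γ.1.1 (1 * t) = _
      rw [one_mul]
    exact congrArg (L.toClass x₀) this

/-! ### The end point map is a covering -/

theorem endpoint_mem_of_mem_extensions {c d : PathClass L x₀} {U : Set X}
    (h : d ∈ L.extensions x₀ c U) : L.endpoint x₀ d ∈ U := by
  obtain ⟨y, z, a, g, -, hg, rfl⟩ := h
  rw [endpoint_toPathClass]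
  exact hg.right_mem

theorem map_endpoint_extensionFilter_le (c : PathClass L x₀) :
    map (L.endpoint x₀) (L.extensionFilter x₀ c) ≤ L.nbhd (L.endpoint x₀ c) := fun U hU =>
  mem_map.2 (mem_extensionFilter.2 ⟨U, hU, fun _ hd => endpoint_mem_of_mem_extensions hd⟩)

theorem eq_of_mem_extensions {c d : PathClass L x₀} {U : Set X} (hU : L.LoopsContract U)
    (h : d ∈ L.extensions x₀ c U) (e : L.endpoint x₀ d = L.endpoint x₀ c) : d = c := by
  obtain ⟨y, z, a, g, rfl, hg, rfl⟩ := h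
  rw [endpoint_toPathClass, endpoint_toPathClass] at e
  subst e
  rw [hU _ g hg, comp_id]

/-- The discrete limit structure: only the principal ultrafilter of `x` converges to `x`. -/
def discrete (X : Type u) : LimitStructure X where
  conv F x := F ≤ pure x
  pure_conv _ := le_rfl
  sup_conv h₁ h₂ := sup_le h₁ h₂
  mono h₁ h₂ := h₂.trans h₁

theorem PathHom.comp_right_cancel {x y z : X} {a b : PathHom L x y} {g : PathHom L y z}
    (h : a.comp g = b.comp g) : a = b := by
  rw [← a.comp_id, ← g.comp_inv, ← comp_assoc, h, comp_assoc, g.comp_inv, b.comp_id]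

/-- A point of `𝒞` over `y ∈ U` is, uniquely, a class of paths from `x₀` to a fixed point `u ∈ U`
followed by the class `θ y` of the paths from `u` to `y` in `U`. -/
theorem isTrivialOver_endpoint (hL : L.IsPretopological) (hp : L.IsLocallyPathConnected)
    {K : LimitStructure (PathClass L x₀)}
    (hK : ∀ F c, K.conv F c ↔ F ≤ L.extensionFilter x₀ c) {U : Set X}
    (hUo : ∀ y ∈ U, U ∈ L.nbhd y) (hUj : L.Joins U) (hUl : L.LoopsContract U) (hne : U.Nonempty) :
    IsTrivialOver K L (L.endpoint x₀) U := by
  obtain ⟨u, hu⟩ := hne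
  -- `θ y` does not depend on choices, as the loops in `U` contract.
  choose θ hθ using fun y : U => hUj u hu y y.2
  let Ψ : U × PathHom L x₀ u → L.endpoint x₀ ⁻¹' U := fun p =>
    ⟨(p.2.comp (θ p.1)).toPathClass, by
      rw [Set.mem_preimage, endpoint_toPathClass]; exact p.1.2⟩
  have hΨ : Function.Bijective Ψ := by
    constructor
    · rintro ⟨y, a⟩ ⟨y', a'⟩ h
      have h' := congrArg Subtype.val h
      have e : (y : X) = y' := by
        simpa only [Ψ, endpoint_toPathClass] using congrArg (L.endpoint x₀) h'
      obtain rfl := Subtype.ext e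
      exact congrArg (Prod.mk y) (comp_right_cancel (toPathClass_injective h'))
    · rintro ⟨c, hc⟩
      obtain ⟨b, hb⟩ := exists_toPathClass c
      refine ⟨(⟨_, hc⟩, b.comp (θ ⟨_, hc⟩).inv), Subtype.ext ?_⟩
      simp only [Ψ, comp_assoc, inv_comp, comp_id, hb]
  have hend : ∀ p, L.endpoint x₀ (Ψ p) = p.1 := fun p => endpoint_toPathClass _
  let Φ : (L.endpoint x₀ ⁻¹' U) ≃ U × PathHom L x₀ u := (Equiv.ofBijective Ψ hΨ).symm
  have hΦΨ : ∀ p, Φ (Ψ p) = p := fun p => (Equiv.ofBijective Ψ hΨ).symm_apply_apply p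
  have hΦe : ∀ e, ((Φ e).1 : X) = L.endpoint x₀ e := by
    intro e
    obtain ⟨p, rfl⟩ := hΨ.2 e
    rw [hΦΨ, hend]
  refine ⟨_, discrete _, Φ, ?_, ?_, hΦe⟩
  · intro c F hF
    obtain ⟨⟨y, a⟩, rfl⟩ := hΨ.2 c
    have hF' : map Subtype.val F ≤ L.extensionFilter x₀ (Ψ (y, a)) := (hK _ _).1 hF
    rw [hΦΨ]
    constructor
    · change L.conv (map Subtype.val (map Prod.fst (map Φ F))) y
      rw [map_map, map_map, hL.conv_iff]
      have e : (Subtype.val ∘ Prod.fst) ∘ Φ = L.endpoint x₀ ∘ Subtype.val := funext hΦe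
      rw [e, ← map_map]
      refine (map_mono hF').trans ((map_endpoint_extensionFilter_le _).trans ?_)
      rw [hend]
    · refine le_pure_iff.2 ?_
      rw [map_map, mem_map]
      have hUe : L.extensions x₀ (Ψ (y, a)) U ∈ L.extensionFilter x₀ (Ψ (y, a)) :=
        mem_extensionFilter.2 ⟨U, by rw [hend]; exact hUo y y.2, le_rfl⟩
      filter_upwards [mem_map.1 (hF' hUe)] with e he
      obtain ⟨z, g, hg, h⟩ := mem_extensions_toPathClass.1 he
      have hz : z ∈ U := hg.right_mem
      have : e = Ψ (⟨z, hz⟩, a) := by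
        apply Subtype.ext
        rw [← h, comp_assoc, hUl.eq ((hθ y).comp hg) (hθ ⟨z, hz⟩)]
      change (Φ e).2 = a
      rw [this, hΦΨ]
  · rintro ⟨y, a⟩ F ⟨hF1, hF2⟩
    have hF1' : map Subtype.val (map Prod.fst F) ≤ L.nbhd y := hL.conv_iff.1 hF1
    rw [map_map] at hF1'
    have hF2' : ∀ᶠ p in F, p.2 = a := mem_map.1 (le_pure_iff.1 hF2)
    refine (hK _ _).2 fun S hS => ?_
    change S ∈ map Subtype.val (map Ψ F)
    rw [map_map, mem_map]
    obtain ⟨W, hW, hWS⟩ := mem_extensionFilter.1 hS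
    have hW' : W ∈ L.nbhd y := by
      have := hend (y, a)
      change L.endpoint x₀ (Ψ (y, a)) = y at this
      rwa [← this]
    obtain ⟨W', hW'y, hW'W, hj⟩ := hp.exists_nbhd hL (inter_mem hW' (hUo y y.2))
    filter_upwards [hF2', mem_map.1 (hF1' hW'y)] with p hp2 hp1
    obtain ⟨z, b⟩ := p
    obtain rfl : b = a := hp2
    obtain ⟨g, hg⟩ := hj y (mem_of_mem_nbhd hW'y) z hp1
    refine hWS (mem_extensions_toPathClass.2 ⟨z, g, hg.mono fun _ h => (hW'W h).1, ?_⟩)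
    rw [comp_assoc, hUl.eq ((hθ y).comp (hg.mono fun _ h => (hW'W h).2)) (hθ z)]
    rfl

/-- An extension of `c` by a short path is `c` itself if it has the same end point. -/
theorem isDiscrete_fibre_endpoint (hL : L.IsPretopological)
    (hs : L.IsSemilocallySimplyConnected) {K : LimitStructure (PathClass L x₀)}
    (hK : ∀ F c, K.conv F c ↔ F ≤ L.extensionFilter x₀ c) (x : X) :
    (K.subspace (L.endpoint x₀ ⁻¹' {x})).IsDiscrete := by
  have key : ∀ (c : L.endpoint x₀ ⁻¹' {x}) F, (K.subspace _).conv F c → {c} ∈ F := by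
    intro c F hF
    obtain ⟨V, hV, hVl⟩ := hs.exists_nbhd hL (L.endpoint x₀ c)
    have hF' : map Subtype.val F ≤ L.extensionFilter x₀ c := (hK _ _).1 hF
    filter_upwards [mem_map.1 (hF' (mem_extensionFilter.2 ⟨V, hV, le_rfl⟩))] with d hd
    exact Subtype.ext (eq_of_mem_extensions hVl hd (d.2.trans c.2.symm))
  refine fun c => ⟨fun d F hF hc hd => ?_, ?_⟩
  · obtain ⟨e, he, he'⟩ := hF.nonempty_of_mem (inter_mem hc (key d F hd))
    exact he'.symm.trans he
  · rintro d rfl F hF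
    exact key d F hF

/-- Such a set consists of the points joined to `x` within the interior of a neighbourhood of `x`
whose loops contract. -/
theorem exists_open_joins_loopsContract {X : Type u} [TopologicalSpace X]
    (hp : (ofTop X).IsLocallyPathConnected) (hs : (ofTop X).IsSemilocallySimplyConnected) (x : X) :
    ∃ U, IsOpen U ∧ x ∈ U ∧ (ofTop X).Joins U ∧ (ofTop X).LoopsContract U := by
  have hL := isPretopological_ofTop (X := X)
  obtain ⟨V, hV, hVl⟩ := hs.exists_nbhd hL x
  rw [nbhd_ofTop] at hV
  let U : Set X := {y | ∃ a : (ofTop X).PathHom x y, a.Within (interior V)}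
  have hUV : U ⊆ interior V := fun y ⟨a, ha⟩ => ha.right_mem
  have hxU : ∀ y ∈ U, ∃ a : (ofTop X).PathHom x y, a.Within U := by
    rintro y ⟨a, f, hf, h0, h1, hfV, -⟩
    refine ⟨PathHom.mk f hf h0 h1, f, hf, h0, h1, fun t => ?_, rfl⟩
    exact ⟨piece f hf 0 t h0 rfl, piece_within hf (b := 0) (c := 1) (fun r _ => hfV r)
      ⟨le_rfl, zero_le_one⟩ ⟨t.2.1, t.2.2⟩ _ _⟩
  refine ⟨U, isOpen_iff_mem_nhds.2 ?_, ⟨PathHom.id _ x, within_id (mem_interior_iff_mem_nhds.2 hV)⟩,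
    fun y hy z hz => ?_, hVl.mono (hUV.trans interior_subset)⟩
  · rintro y ⟨a, ha⟩
    obtain ⟨W, hW, hWV, hj⟩ := hp.exists_nbhd hL
      (by rw [nbhd_ofTop]; exact isOpen_interior.mem_nhds ha.right_mem :
        interior V ∈ (ofTop X).nbhd y)
    rw [nbhd_ofTop] at hW
    filter_upwards [hW] with z hz
    obtain ⟨g, hg⟩ := hj y (mem_of_mem_nhds hW) z hz
    exact ⟨a.comp g, ha.comp (hg.mono hWV)⟩
  · obtain ⟨a, ha⟩ := hxU y hy
    obtain ⟨b, hb⟩ := hxU z hz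
    exact ⟨a.inv.comp b, ha.inv.comp hb⟩

theorem isCovering_endpoint {X : Type u} [TopologicalSpace X] {x₀ : X}
    (hc : (ofTop X).IsConnected) (hp : (ofTop X).IsLocallyPathConnected)
    (hs : (ofTop X).IsSemilocallySimplyConnected)
    {K : LimitStructure (PathClass (ofTop X) x₀)}
    (hK : ∀ F c, K.conv F c ↔ F ≤ (ofTop X).extensionFilter x₀ c) :
    IsCovering K (ofTop X) ((ofTop X).endpoint x₀) := by
  have hL := isPretopological_ofTop (X := X)
  refine ⟨fun c F hF => ?_, fun y => ?_, ⟨{U | IsOpen U ∧ U.Nonempty ∧ (ofTop X).Joins U ∧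
    (ofTop X).LoopsContract U}, fun x F hF => ?_, fun U hU => ?_⟩,
    isDiscrete_fibre_endpoint hL hs hK⟩
  · exact hL.conv_iff.2 ((map_mono ((hK _ _).1 hF)).trans (map_endpoint_extensionFilter_le c))
  · obtain ⟨a⟩ := exists_pathHom hL hc hp x₀ y
    exact ⟨a.toPathClass, endpoint_toPathClass a⟩
  · obtain ⟨U, hUo, hx, hj, hl⟩ := exists_open_joins_loopsContract hp hs x
    exact ⟨U, ⟨hUo, ⟨x, hx⟩, hj, hl⟩, hF (hUo.mem_nhds hx)⟩
  · exact isTrivialOver_endpoint hL hp hK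
      (fun y hy => by rw [nbhd_ofTop]; exact hU.1.mem_nhds hy) hU.2.2.1 hU.2.2.2 hU.2.1

/-! ### Coverings of topological spaces -/

section CoveringOfTop

variable {X : Type u} [TopologicalSpace X] {E : Type v} {K : LimitStructure E} {p : E → X}
  {U : Set X} {F : Type v} {N : LimitStructure F} {Φ : (p ⁻¹' U) ≃ U × F}

/-- The topology whose open sets are the open sets of the limit space. -/
abbrev topology (K : LimitStructure E) : TopologicalSpace E where
  IsOpen A := K.IsOpenSet A
  isOpen_univ _ _ _ _ := univ_mem
  isOpen_inter _ _ hA hB x hx G hG := inter_mem (hA x hx.1 G hG) (hB x hx.2 G hG)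
  isOpen_sUnion _ hS x := fun ⟨A, hA, hx⟩ G hG =>
    mem_of_superset (hS A hA x hx G hG) (Set.subset_sUnion_of_mem hA)

/-- The fibre of a local trivialization of a map with discrete fibres is discrete. -/
theorem le_pure_of_conv (hd : ∀ x, (K.subspace (p ⁻¹' {x})).IsDiscrete)
    (hΦ' : Cont (prod ((ofTop X).subspace U) N) (K.subspace (p ⁻¹' U)) Φ.symm)
    (hΦp : ∀ e, ((Φ e).1 : X) = p e) (x : U) {G : Filter F} {a : F} (h : N.conv G a) :
    G ≤ pure a := by
  let j : F → p ⁻¹' {(x : X)} := fun b => ⟨Φ.symm (x, b), by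
    rw [Set.mem_preimage, ← hΦp, Equiv.apply_symm_apply]; rfl⟩
  have hj : Function.Injective j := fun b b' hb =>
    congrArg Prod.snd (Φ.symm.injective (Subtype.ext (congrArg Subtype.val hb :)))
  have h1 : (prod ((ofTop X).subspace U) N).conv (map (fun b => (x, b)) G) (x, a) := by
    constructor
    · rw [map_map]
      exact cont_const (M := N) x a G h
    · rw [map_map]
      exact h
  have h2 : (K.subspace (p ⁻¹' {(x : X)})).conv (map j G) (j a) := by
    have := hΦ' _ _ h1
    change K.conv (map Subtype.val (map j G)) _
    change K.conv (map Subtype.val (map Φ.symm (map (fun b => (x, b)) G))) _ at this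
    rw [map_map, map_map] at this
    rw [map_map]
    exact this
  refine le_pure_iff.2 ?_
  filter_upwards [mem_map.1 ((hd x (j a)).2 (j a) rfl _ h2)] with b hb
  exact hj hb

/-- In a covering of a topological space, a filter converges to `e` iff it converges in the base and
eventually stays in the sheet of `e`. -/
theorem covering_conv_iff (hp : Cont K (ofTop X) p)
    (hd : ∀ x, (K.subspace (p ⁻¹' {x})).IsDiscrete)
    (hΦ : Cont (K.subspace (p ⁻¹' U)) (prod ((ofTop X).subspace U) N) Φ)
    (hΦ' : Cont (prod ((ofTop X).subspace U) N) (K.subspace (p ⁻¹' U)) Φ.symm)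
    (hΦp : ∀ e, ((Φ e).1 : X) = p e) {e : p ⁻¹' U} (he : p e ∈ interior U) {G : Filter E} :
    K.conv G e ↔ map p G ≤ 𝓝 (p e) ∧ ∀ᶠ e' in G, ∃ h : e' ∈ p ⁻¹' U, (Φ ⟨e', h⟩).2 = (Φ e).2 := by
  have hU : U ∈ 𝓝 (p e) := mem_interior_iff_mem_nhds.1 he
  have hval : map p G ≤ 𝓝 (p e) → map Subtype.val (comap (Subtype.val : p ⁻¹' U → E) G) = G := by
    intro h
    rw [map_comap, Subtype.range_val]
    exact inf_eq_left.2 (le_principal_iff.2 (h hU))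
  constructor
  · intro h
    have hpG : map p G ≤ 𝓝 (p e) := hp _ _ h
    refine ⟨hpG, ?_⟩
    have h1 : (K.subspace (p ⁻¹' U)).conv (comap Subtype.val G) e := by
      change K.conv (map Subtype.val (comap Subtype.val G)) e
      rwa [hval hpG]
    have h2 := le_pure_of_conv hd hΦ' hΦp (Φ e).1 (hΦ _ _ h1).2
    have h3 : ∀ᶠ q in comap (Subtype.val : p ⁻¹' U → E) G, (Φ q).2 = (Φ e).2 :=
      mem_map.1 (mem_map.1 (le_pure_iff.1 h2))
    rw [← hval hpG, eventually_map]
    filter_upwards [h3] with q hq using ⟨q.2, hq⟩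
  · rintro ⟨hpG, hs⟩
    have h1 : (prod ((ofTop X).subspace U) N).conv
        (map Φ (comap (Subtype.val : p ⁻¹' U → E) G)) (Φ e) := by
      constructor
      · change map Subtype.val (map Prod.fst (map Φ _)) ≤ 𝓝 ((Φ e).1 : X)
        have e' : (Subtype.val ∘ Prod.fst) ∘ Φ = p ∘ Subtype.val := funext hΦp
        rw [map_map, map_map, e', ← map_map, hval hpG, hΦp]
        exact hpG
      · refine N.mono (N.pure_conv _) (le_pure_iff.2 ?_)
        rw [← hval hpG, eventually_map] at hs
        rw [map_map, mem_map]
        filter_upwards [hs] with q hq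
        exact hq.2
    have h2 := hΦ' _ _ h1
    change K.conv (map Subtype.val (map Φ.symm (map Φ _))) (Φ.symm (Φ e) : E) at h2
    rw [map_map (m := Φ), Equiv.symm_comp_self, map_id, hval hpG, Equiv.symm_apply_apply] at h2
    exact h2

/-- A covering of a topological space in the category of limit spaces is a covering in the
topological sense. -/
theorem IsCovering.isCoveringMap (h : IsCovering K (ofTop X) p) :
    (∀ G e, K.conv G e ↔ G ≤ @nhds E K.topology e) ∧
      @IsCoveringMap E X K.topology _ p := by
  let _ := K.topology
  obtain ⟨hp, hsurj, ⟨C, hC, htriv⟩, hd⟩ := h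
  have hpc : Continuous p := by
    refine continuous_def.2 fun O hO e he G hG => ?_
    exact hp _ _ hG (hO.mem_nhds he)
  have hloc : ∀ x : X, ∃ U, x ∈ interior U ∧ IsTrivialOver K (ofTop X) p U := by
    intro x
    obtain ⟨U, hUC, hU⟩ := hC x (𝓝 x) le_rfl
    exact ⟨U, mem_interior_iff_mem_nhds.2 hU, htriv U hUC⟩
  have hconv : ∀ G e, K.conv G e ↔ G ≤ 𝓝 e := by
    intro G e
    constructor
    · intro hG A hA
      obtain ⟨O, hOA, hO, he⟩ := mem_nhds_iff.1 hA
      exact mem_of_superset (hO e he G hG) hOA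
    · intro hG
      obtain ⟨U, hU, F, N, Φ, hΦ, hΦ', hΦp⟩ := hloc (p e)
      let e₁ : p ⁻¹' U := ⟨e, (interior_subset hU : p e ∈ U)⟩
      refine (covering_conv_iff hp hd hΦ hΦ' hΦp (e := e₁) hU).2
        ⟨(map_mono hG).trans (hpc.tendsto e), ?_⟩
      have hO : IsOpen {e' | p e' ∈ interior U ∧
          ∃ h : e' ∈ p ⁻¹' U, (Φ ⟨e', h⟩).2 = (Φ e₁).2} := by
        rintro e' ⟨he', h, hs⟩ G' hG'
        obtain ⟨h1, h2⟩ := (covering_conv_iff hp hd hΦ hΦ' hΦp (e := ⟨e', h⟩) he').1 hG'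
        filter_upwards [h1 (isOpen_interior.mem_nhds he'), h2] with q hq1 hq2
        exact ⟨hq1, hq2.1, hq2.2.trans hs⟩
      filter_upwards [hG (hO.mem_nhds ⟨hU, e₁.2, rfl⟩)] with q hq using hq.2
  refine ⟨hconv, fun x => ?_⟩
  obtain ⟨U, hU, F, N, Φ, hΦ, hΦ', hΦp⟩ := hloc x
  let _ : TopologicalSpace F := ⊥
  have : DiscreteTopology F := ⟨rfl⟩
  have hIU : ∀ {e}, e ∈ p ⁻¹' interior U → e ∈ p ⁻¹' U := fun h =>
    (interior_subset h : p _ ∈ U)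
  let H : (p ⁻¹' interior U) ≃ₜ interior U × F :=
    { toFun := fun e => (⟨p e, e.2⟩, (Φ ⟨e, hIU e.2⟩).2)
      invFun := fun q => ⟨Φ.symm (⟨q.1, interior_subset q.1.2⟩, q.2), by
        rw [Set.mem_preimage, ← hΦp, Equiv.apply_symm_apply]; exact q.1.2⟩
      left_inv := by
        rintro ⟨e, he⟩
        apply Subtype.ext
        have : (⟨⟨p e, hIU he⟩, (Φ ⟨e, hIU he⟩).2⟩ : U × F) = Φ ⟨e, hIU he⟩ :=
          Prod.ext (Subtype.ext (hΦp ⟨e, hIU he⟩).symm) rfl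
        change (Φ.symm (⟨⟨p e, hIU he⟩, (Φ ⟨e, hIU he⟩).2⟩ : U × F) : E) = e
        rw [this, Equiv.symm_apply_apply]
      right_inv := by
        rintro ⟨y, a⟩
        refine Prod.ext (Subtype.ext ?_) ?_
        · change p (Φ.symm _ : E) = y
          rw [← hΦp, Equiv.apply_symm_apply]
        · change (Φ (Φ.symm _)).2 = a
          rw [Equiv.apply_symm_apply]
      continuous_toFun := by
        refine Continuous.prodMk (Continuous.subtype_mk (hpc.comp continuous_subtype_val) _) ?_
        refine continuous_iff_continuousAt.2 fun e => ?_
        rw [ContinuousAt, nhds_discrete F, tendsto_pure]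
        have := ((covering_conv_iff hp hd hΦ hΦ' hΦp (e := ⟨e, hIU e.2⟩) e.2).1
          ((hconv (𝓝 (e : E)) e).2 le_rfl)).2
        filter_upwards [continuous_subtype_val.continuousAt.eventually this] with q hq
        exact hq.2
      continuous_invFun := by
        refine Continuous.subtype_mk (continuous_iff_continuousAt.2 ?_) _
        rintro ⟨y, a⟩
        let e₁ : p ⁻¹' U := Φ.symm (⟨y, interior_subset y.2⟩, a)
        have he₁ : p e₁ = y := by rw [← hΦp, Equiv.apply_symm_apply]
        refine (hconv _ _).1 ((covering_conv_iff hp hd hΦ hΦ' hΦp (e := e₁)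
          (he₁ ▸ y.2)).2 ⟨?_, ?_⟩)
        · have e' : p ∘ (fun q : interior U × F =>
              (Φ.symm (⟨q.1, interior_subset q.1.2⟩, q.2) : E)) = fun q => (q.1 : X) := by
            funext q
            rw [Function.comp, ← hΦp, Equiv.apply_symm_apply]
          rw [map_map, e', he₁]
          exact (continuous_subtype_val.comp continuous_fst).tendsto (y, a)
        · rw [eventually_map, nhds_prod_eq, nhds_discrete F]
          have : ∀ᶠ q in 𝓝 y ×ˢ pure a, q.2 = a := tendsto_snd (mem_pure.2 rfl : {a} ∈ pure a)
          filter_upwards [this] with q hq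
          refine ⟨Subtype.property _, ?_⟩
          simp only [Subtype.coe_eta, Equiv.apply_symm_apply, e₁, hq] }
  exact (show IsEvenlyCovered p x F from ⟨inferInstance, interior U, hU, isOpen_interior,
    isOpen_interior.preimage hpc, H, fun _ => rfl⟩).to_isEvenlyCovered_preimage

end CoveringOfTop

/-! ### Lifting to coverings -/

/-- A path in a topological space, as a bundled continuous map. -/
def pathMap {X : Type u} [TopologicalSpace X] {x₀ : X} (γ : PathSpace (ofTop X) x₀) : C(I, X) :=
  ⟨γ.1.1, cont_ofTop_iff.1 γ.1.2⟩

/-- The end point map lifts through every covering: `[γ]` is sent to the end point of the lift of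
`γ` which starts at `e₀`. -/
theorem exists_lift_endpoint {X : Type u} [TopologicalSpace X] {x₀ : X} {E : Type v}
    [TopologicalSpace E] {p : E → X} (cov : IsCoveringMap p) (e₀ : E) (he₀ : p e₀ = x₀) :
    ∃ f : PathClass (ofTop X) x₀ → E,
      (∀ c, map f ((ofTop X).extensionFilter x₀ c) ≤ 𝓝 (f c)) ∧
        p ∘ f = (ofTop X).endpoint x₀ := by
  have h0 : ∀ γ : PathSpace (ofTop X) x₀, pathMap γ 0 = p e₀ := fun γ => γ.2.trans he₀.symm
  let l : PathSpace (ofTop X) x₀ → E := fun γ => cov.liftPath (pathMap γ) e₀ (h0 γ) 1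
  have hl : ∀ γ γ', (pathSetoid (ofTop X) x₀).r γ γ' → l γ = l γ' := by
    rintro γ γ' ⟨-, H, hH, H0, H1, Hl, Hr⟩
    rw [cont_prod_interval_iff, cont_ofTop_iff] at hH
    refine cov.liftPath_apply_one_eq_of_homotopicRel ⟨?_⟩ e₀ (h0 γ) (h0 γ')
    exact
      { toFun := fun q => H (q.2, q.1)
        continuous_toFun := hH.comp (continuous_snd.prodMk continuous_fst)
        map_zero_left := H0
        map_one_left := H1
        prop' := by
          rintro t s (rfl | hs)
          · exact Hl t
          · rw [Set.mem_singleton_iff.1 hs]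
            exact Hr t }
  let f : PathClass (ofTop X) x₀ → E := Quotient.lift l hl
  have hf : ∀ γ, f ((ofTop X).toClass x₀ γ) = l γ := fun _ => rfl
  have hpl : ∀ γ, p (l γ) = γ.1.1 1 := fun γ =>
    congrFun (cov.liftPath_lifts (pathMap γ) e₀ (h0 γ)) 1
  refine ⟨f, fun c => ?_, ?_⟩
  · obtain ⟨γ, rfl⟩ := (ofTop X).toClass_surjective x₀ c
    -- Near `l γ` the covering has a local section, and the lift of an extension of `γ` by a short
    -- path `α` is the lift of `γ` followed by the image of `α` under that section.
    obtain ⟨ψ, hψ, hpψ⟩ := cov.isLocalHomeomorph (l γ)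
    intro O hO
    rw [hf] at hO
    have hpe : ψ (l γ) = γ.1.1 1 := by rw [← hpψ, hpl]
    have hsymm : ψ.symm (γ.1.1 1) = l γ := by rw [← hpe, ψ.left_inv hψ]
    have ht : γ.1.1 1 ∈ ψ.target := hpe ▸ ψ.map_source hψ
    have hW : ψ.target ∩ ψ.symm ⁻¹' O ∈ 𝓝 (γ.1.1 1) := by
      refine inter_mem (ψ.open_target.mem_nhds ht) (ψ.continuousAt_symm ht ?_)
      rwa [hsymm]
    refine mem_map.2 (mem_extensionFilter.2 ⟨_, by rw [nbhd_ofTop]; exact hW, fun d hd => ?_⟩)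
    obtain ⟨z, g, ⟨α, hα, hα0, hα1, hαW, rfl⟩, rfl⟩ :=
      (mem_extensions_toPathClass (a := PathHom.mk γ.1.1 γ.1.2 γ.2 rfl)).1 hd
    let μ : PathSpace (ofTop X) x₀ := toPathSpace (concat γ.1.1 α)
      (cont_concat γ.1.2 hα hα0.symm) ((concat_zero _ _).trans γ.2)
    have hαc : Continuous α := cont_ofTop_iff.1 hα
    have key : concat (cov.liftPath (pathMap γ) e₀ (h0 γ)) (ψ.symm ∘ α) =
        cov.liftPath (pathMap μ) e₀ (h0 μ) := by
      refine (cov.eq_liftPath_iff (h0 μ)).2 ⟨?_, ?_, ?_⟩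
      · refine continuous_concat (ContinuousMap.continuous _)
          (ψ.continuousOn_symm.comp_continuous hαc fun t => (hαW t).1) ?_
        rw [Function.comp, hα0, hsymm]
      · rw [comp_concat, cov.liftPath_lifts]
        have : p ∘ ψ.symm ∘ α = α := funext fun t => by
          rw [hpψ]; exact ψ.right_inv (hαW t).1
        rw [this]
        rfl
      · rw [concat_zero, cov.liftPath_zero]
    have hμ : l μ = ψ.symm (α 1) := by
      change cov.liftPath (pathMap μ) e₀ (h0 μ) 1 = _
      rw [← key, concat_one]
      rfl
    change l μ ∈ O
    rw [hμ]
    exact (hαW 1).2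
  · funext c
    obtain ⟨γ, rfl⟩ := (ofTop X).toClass_surjective x₀ c
    exact hpl γ

theorem isUniversalCovering_endpoint {X : Type u} [TopologicalSpace X] {x₀ : X}
    (hc : (ofTop X).IsConnected) (hp : (ofTop X).IsLocallyPathConnected)
    (hs : (ofTop X).IsSemilocallySimplyConnected) :
    IsUniversalCovering.{u, u, v} ((ofTop X).classStructure x₀) (ofTop X)
      ((ofTop X).endpoint x₀) := by
  have hK : ∀ F c, ((ofTop X).classStructure x₀).conv F c ↔ F ≤ (ofTop X).extensionFilter x₀ c :=
    fun F c => classStructure_conv_iff isPretopological_ofTop hp hs openAlongPaths_ofTop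
  refine ⟨isCovering_endpoint hc hp hs hK, isConnected_classStructure, fun E K p h _ => ?_⟩
  obtain ⟨e₀, he₀⟩ := h.2.1 x₀
  let _ := K.topology
  obtain ⟨hconv, cov⟩ := h.isCoveringMap
  obtain ⟨f, hf, hpf⟩ := exists_lift_endpoint cov e₀ he₀
  exact ⟨f, fun c F hF => (hconv _ _).2 ((map_mono ((hK F c).1 hF)).trans (hf c)), hpf⟩

end LimitStructure

theorem mainTheorem10 :
    -- the pretopological case
    (∀ (X : Type u) (L : LimitStructure X) (x₀ : X),
      L.IsConnected → L.IsLocallyPathConnected → L.IsSemilocallySimplyConnected →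
      L.IsPretopological →
      (LimitStructure.contStructure LimitStructure.interval L).IsPretopological →
      (L.classStructure x₀).IsPretopological) ∧
    -- the topological case
    (∀ (X : Type u) [TopologicalSpace X] (x₀ : X),
      (LimitStructure.ofTop X).IsConnected →
      (LimitStructure.ofTop X).IsLocallyPathConnected →
      (LimitStructure.ofTop X).IsSemilocallySimplyConnected →
      ((LimitStructure.ofTop X).classStructure x₀).IsPretopological ∧
      ((LimitStructure.ofTop X).classStructure x₀).pretopModification =
        ((LimitStructure.ofTop X).pathStructure x₀).pseudotopQuotient
          ((LimitStructure.ofTop X).toClass x₀) ∧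
      LimitStructure.IsUniversalCovering.{u, u, v}
        ((LimitStructure.ofTop X).classStructure x₀).pretopModification
        (LimitStructure.ofTop X) ((LimitStructure.ofTop X).endpoint x₀)) := by
  refine ⟨fun X L x₀ _ hp hs hL hC => ?_, fun X _ x₀ hc hp hs => ?_⟩
  · exact LimitStructure.classStructure_isPretopological hL hp hs
      (LimitStructure.openAlongPaths_of_isPretopological_contStructure hL hp hC)
  · have h : ((LimitStructure.ofTop X).classStructure x₀).IsPretopological :=
      LimitStructure.classStructure_isPretopological LimitStructure.isPretopological_ofTop hp hs
        LimitStructure.openAlongPaths_ofTop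
    rw [h.pretopModification_eq]
    exact ⟨h, LimitStructure.quotient_eq_pseudotopQuotient _ h.isPseudotopological,
      LimitStructure.isUniversalCovering_endpoint hc hp hs⟩
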